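/- Let $r,p\ge 1$ and $m\ge p+r$ be integers, let $a_{-r},\dots,a_p\in\mathbb C$ with $a_{-r}\ne0$ and $a_p\neq 0$, and let $B=(b_{j,k})_{-r\le j\le -1,\;0\le k\le m-1}\in\mathcal M_{r,m}(\mathbb C)$. Consider the scheme $U_j^{n+1}=\sum_{k=-r}^p a_kU_{j+k}^n$ $(j\ge 0)$ with boundary conditions $U_j^n=\sum_{k=0}^{m-1}b_{j,k}U_k^n+g_j^n$ $(-r\le j\le -1)$, and let $\mathcal B\in\mathcal M_{r,m}(\mathbb C)$ be the matrix obtained by substituting the boundary conditions into the scheme for $0\le j\le r-1$, that is, $\mathcal B=TB+S$, where, for $0\le i,l\le r-1$ and $0\le k\le m-1$, $T_{i,l}=a_{-r+l-i}$ if $i\le l$ and $T_{i,l}=0$ otherwise, and $S_{i,k}=a_{k-i}$ if $k-i\le p$ and $S_{i,k}=0$ otherwise (row $l$ of $B$ being $(b_{l-r,k})_k$). Assume that the scheme is Cauchy stable: $\bigl|\sum_{k=-r}^p a_ke^{ik\xi}\bigr|\le 1$ for all $\xi\in\mathbb R$. Write $\mathbb S=\{|z|=1\}$, $\mathbb D=\{|z|<1\}$,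 $\mathcal U=\{|z|>1\}$ and $\overline{\mathcal U}=\{|z|\ge1\}$. For $z\in\mathcal U$, the polynomial $P_z(\kappa)=\sum_{k=-r}^p a_k\kappa^{r+k}-z\kappa^r$ has exactly $r$ roots in $\mathbb D$, counted with multiplicity; call them the stable roots at $z$. For $z\in\mathbb S$, the stable roots at $z$ are the roots of $P_z$ coming from $\mathbb D$, i.e. the limit (as an unordered $r$-tuple) of the stable roots at $w$ as $w\to z$, $w\in\mathcal U$. For $z\in\overline{\mathcal U}$ and $n\ge 1$, let $K_{0,n-1}(z)\in\mathcal M_{n,r}(\mathbb C)$ be the matrix whose columns are the vectors $(j^s\kappa^j)_{0\le j\le n-1}$, where $\kappa$ runs through the distinct stable roots at $z$ and $0\le s<\mu(\kappa)$ with $\mu(\kappa)$ the multiplicity of $\kappa$ among the stable roots (and $0^0=1$). The intrinsic Kreiss--Lopatinskii determinant is $$\Delta(z)=\frac{\det\bigl(zK_{0,r-1}(z)-\mathcal B K_{0,m-1}(z)\bigr)}{\det K_{0,r-1}(z)},\qquad z\in\overline{\mathcal U},$$ which does not depend on the order of the columns. If $0\notin\Delta(\mathbb S)$, then $\Delta$,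 which is holomorphic on $\mathcal U$ and continuous on $\overline{\mathcal U}$, has finitely many zeros in $\mathcal U$, and their number, counted with multiplicity, is exactly $$r-\mathrm{Ind}_{\Delta(\mathbb S)}(0),$$ where $\mathrm{Ind}_{\Delta(\mathbb S)}(0)\in\mathbb Z$ is the winding number around $0$ of the closed curve $\theta\in[0,2\pi]\mapsto\Delta(e^{i\theta})$. -/

import Mathlib

noncomputable section

namespace KreissLopatinskii

/-- The symbol `γ(ξ) = ∑_{k=-r}^p a_k e^{ikξ}` of the scheme
`U_j^{n+1} = ∑_{k=-r}^p a_k U_{j+k}^n`. Only the values `a k`, `-r ≤ k ≤ p`, matter. -/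
def symbol (r p : ℕ) (a : ℤ → ℂ) (ξ : ℝ) : ℂ :=
  ∑ k ∈ Finset.Icc (-(r : ℤ)) (p : ℤ), a k * Complex.exp (Complex.I * (k : ℂ) * (ξ : ℂ))

/-- Cauchy stability: the symbol takes its values in the closed unit disk. -/
def CauchyStable (r p : ℕ) (a : ℤ → ℂ) : Prop :=
  ∀ ξ : ℝ, ‖symbol r p a ξ‖ ≤ 1

/-- The matrix `𝓑 ∈ M_{r,m}(ℂ)` obtained by substituting the boundary conditions
`U_j = ∑_{k=0}^{m-1} b_{j,k} U_k + g_j`, `-r ≤ j ≤ -1`, into the interior scheme at the indices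
`0, …, r-1`. The row `l` of `B` holds the coefficients `b_{l-r,k}`. -/
def boundaryMatrix (r p m : ℕ) (a : ℤ → ℂ) (B : Matrix (Fin r) (Fin m) ℂ) :
    Matrix (Fin r) (Fin m) ℂ :=
  (Matrix.of fun i l : Fin r => if i ≤ l then a (-(r : ℤ) + ((l : ℤ) - (i : ℤ))) else 0) * B +
    Matrix.of fun (i : Fin r) (k : Fin m) =>
      if (k : ℤ) - (i : ℤ) ≤ (p : ℤ) then a ((k : ℤ) - (i : ℤ)) else 0

/-- The polynomial `P_z(κ) = ∑_{k=-r}^p a_k κ^{r+k} - z κ^r` of the characteristic equation. -/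
def charPoly (r p : ℕ) (a : ℤ → ℂ) (z : ℂ) : Polynomial ℂ :=
  (∑ l ∈ Finset.range (r + p + 1), Polynomial.C (a ((l : ℤ) - (r : ℤ))) * Polynomial.X ^ l) -
    Polynomial.C z * Polynomial.X ^ r

/-- `κ` lists, with multiplicity, the roots of `P_z` in the open unit disk. -/
def EnumeratesInnerRoots (r p : ℕ) (a : ℤ → ℂ) (z : ℂ) (κ : Fin r → ℂ) : Prop :=
  Finset.univ.val.map κ = (charPoly r p a z).roots.filter fun x => ‖x‖ < 1

/-- `κ` lists, with multiplicity, the stable roots at the point `z`, `|z| ≥ 1`. For `|z| > 1` these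
are the roots of `P_z` in the open unit disk; for `|z| = 1` these are the roots of `P_z` that come
from the inside, i.e. the limit, as an unordered `r`-tuple, of the roots of `P_w` in the open unit
disk as `w → z` with `|w| > 1`. -/
def IsStableRoots (r p : ℕ) (a : ℤ → ℂ) (z : ℂ) (κ : Fin r → ℂ) : Prop :=
  (1 < ‖z‖ ∧ EnumeratesInnerRoots r p a z κ) ∨
  (‖z‖ = 1 ∧ ∀ ε > 0, ∃ δ > 0, ∀ w : ℂ, 1 < ‖w‖ → ‖w - z‖ < δ →
    ∃ κ' : Fin r → ℂ, EnumeratesInnerRoots r p a w κ' ∧ ∀ i, ‖κ' i - κ i‖ < ε)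

open Classical in
/-- A choice of an ordering of the `r` stable roots at `z`. -/
def stableRoots (r p : ℕ) (a : ℤ → ℂ) (z : ℂ) : Fin r → ℂ :=
  if h : ∃ κ, IsStableRoots r p a z κ then h.choose else 0

/-- The rows `0, …, n-1` of the basis `(j^s κ_ℓ^j)_j`, `0 ≤ s < mult(κ_ℓ)`, attached to a list `κ`
of roots in which each root occurs as often as its multiplicity: the exponent `s` of a column is the
number of earlier occurrences of the same root. -/
def basisMatrix {r : ℕ} (n : ℕ) (κ : Fin r → ℂ) : Matrix (Fin n) (Fin r) ℂ :=
  Matrix.of fun j i =>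
    ((j : ℕ) : ℂ) ^ (Finset.univ.filter fun l : Fin r => l < i ∧ κ l = κ i).card * κ i ^ (j : ℕ)

/-- The matrix `K_{0,n-1}(z)`. -/
def K (r p : ℕ) (a : ℤ → ℂ) (n : ℕ) (z : ℂ) : Matrix (Fin n) (Fin r) ℂ :=
  basisMatrix n (stableRoots r p a z)

/-- The Kreiss-Lopatinskii determinant `det (z K_{0,r-1}(z) - 𝓑 K_{0,m-1}(z))`. -/
def detKL (r p m : ℕ) (a : ℤ → ℂ) (B : Matrix (Fin r) (Fin m) ℂ) (z : ℂ) : ℂ :=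
  (z • K r p a r z - boundaryMatrix r p m a B * K r p a m z).det

/-- The intrinsic Kreiss-Lopatinskii determinant `Δ`, for `|z| ≥ 1`. -/
def intrinsicDet (r p m : ℕ) (a : ℤ → ℂ) (B : Matrix (Fin r) (Fin m) ℂ) (z : ℂ) : ℂ :=
  detKL r p m a B z / (K r p a r z).det

/-- The integer `w` is the winding number around `z₀` of the closed curve `c : [0, 2π] → ℂ`:
there is a continuous logarithm of `c - z₀` along `[0, 2π]` that increases by `2πi w`. -/
def HasWindingNumber (c : ℝ → ℂ) (z₀ : ℂ) (w : ℤ) : Prop :=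
  ∃ L : ℝ → ℂ, ContinuousOn L (Set.Icc 0 (2 * Real.pi)) ∧
    (∀ θ ∈ Set.Icc 0 (2 * Real.pi), c θ - z₀ = Complex.exp (L θ)) ∧
    L (2 * Real.pi) - L 0 = 2 * (Real.pi : ℂ) * Complex.I * (w : ℂ)

theorem HasWindingNumber.unique {c : ℝ → ℂ} {z₀ : ℂ} {w w' : ℤ}
    (h : HasWindingNumber c z₀ w) (h' : HasWindingNumber c z₀ w') : w = w' := by
  obtain ⟨L, hL, hc, hw⟩ := h
  obtain ⟨L', hL', hc', hw'⟩ := h'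
  have hpi : (0 : ℝ) ≤ 2 * Real.pi := by positivity
  have key : ∀ θ ∈ Set.Icc 0 (2 * Real.pi), ∃ n : ℤ,
      L θ = L' θ + n * (2 * Real.pi * Complex.I) := fun θ hθ =>
    Complex.exp_eq_exp_iff_exists_int.1 ((hc θ hθ).symm.trans (hc' θ hθ))
  have hne : (2 * (Real.pi : ℂ) * Complex.I) ≠ 0 := Complex.two_pi_I_ne_zero
  have hcont : ContinuousOn (fun θ => ((L θ - L' θ) / (2 * Real.pi * Complex.I)).re)
      (Set.Icc 0 (2 * Real.pi)) :=
    Complex.continuous_re.comp_continuousOn ((hL.sub hL').div_const _)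
  have hval : ∀ θ ∈ Set.Icc 0 (2 * Real.pi), ∃ n : ℤ,
      L θ - L' θ = n * (2 * Real.pi * Complex.I) ∧
      ((L θ - L' θ) / (2 * Real.pi * Complex.I)).re = n := by
    intro θ hθ
    obtain ⟨n, hn⟩ := key θ hθ
    have e : L θ - L' θ = n * (2 * Real.pi * Complex.I) := by rw [hn]; ring
    refine ⟨n, e, ?_⟩
    rw [e, mul_div_cancel_right₀ _ hne]
    simp
  obtain ⟨n₀, e₀, v₀⟩ := hval 0 ⟨le_rfl, hpi⟩
  obtain ⟨n₁, e₁, v₁⟩ := hval (2 * Real.pi) ⟨hpi, le_rfl⟩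
  have hn : n₀ = n₁ := by
    have hconn := (isPreconnected_Icc (a := (0 : ℝ)) (b := 2 * Real.pi)).image _ hcont
    have hsub : (fun θ => ((L θ - L' θ) / (2 * Real.pi * Complex.I)).re) ''
        Set.Icc 0 (2 * Real.pi) ⊆ Set.range ((↑) : ℤ → ℝ) := by
      rintro _ ⟨θ, hθ, rfl⟩
      obtain ⟨n, -, hn⟩ := hval θ hθ
      exact ⟨n, hn.symm⟩
    have hd : (Set.range ((↑) : ℤ → ℝ)).Countable := Set.countable_range _
    have hs := hd.isTotallyDisconnected _ hsub hconn
    have := hs ⟨0, ⟨le_rfl, hpi⟩, rfl⟩ ⟨2 * Real.pi, ⟨hpi, le_rfl⟩, rfl⟩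
    simp only [v₀, v₁] at this
    exact_mod_cast this
  have e : ((w : ℂ) - w') * (2 * Real.pi * Complex.I) = 0 := by
    have : L (2 * Real.pi) - L' (2 * Real.pi) = L 0 - L' 0 := by rw [e₀, e₁, hn]
    linear_combination (-1 : ℂ) * hw + hw' + this
  have := (mul_eq_zero.1 e).resolve_right hne
  exact_mod_cast sub_eq_zero.1 this

open Classical in
/-- The winding number around `z₀` of a closed curve `c : [0, 2π] → ℂ`; it is defined whenever `c`
is continuous on `[0, 2π]`, closed, and avoids `z₀`. -/
def windingNumber (c : ℝ → ℂ) (z₀ : ℂ) : ℤ :=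
  if h : ∃ w, HasWindingNumber c z₀ w then h.choose else 0

end KreissLopatinskii

end

/-!
In the variable `ζ = 1 / z` the monic polynomial of the stable roots of `P_z` is analytic on the
open unit disk and continuous on the closed one, with value `X ^ r` at `ζ = 0`: its roots stay away
from the unit circle when `|ζ| < 1`, so that its power sums are contour integrals. Rows of the
confluent Vandermonde matrix `K_{0,m-1}` are obtained from those of `K_{0,r-1}` by reducing `X ^ j`
modulo this polynomial, and since `0` is not a stable root, `det K_{0,r-1}` does not vanish. Hence
`Δ(z) = z ^ r h(1 / z)`, where `h` is a determinant with entries analytic in `ζ` and `h(0) = 1`.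
The argument principle for `h` on the unit disk, read through the orientation-reversing inversion
of the circle, gives the count `r - Ind`.
-/

noncomputable section

namespace KreissLopatinskii

open Polynomial Metric Topology Filter

section ConfluentVandermonde

/-- The Euler operator `X d/dX`, of which `X ^ j` is an eigenvector with eigenvalue `j`; it produces
the factors `j ^ s` in the basis matrices. -/
def eulerOp {R : Type*} [CommRing R] : R[X] →ₗ[R] R[X] :=
  LinearMap.mulLeft R X ∘ₗ derivative

theorem eulerOp_apply {R : Type*} [CommRing R] (f : R[X]) : eulerOp f = X * derivative f := rfl

theorem eulerOp_pow_X_pow {R : Type*} [CommRing R] (s j : ℕ) :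
    (eulerOp ^ s) (X ^ j : R[X]) = (j : R) ^ s • X ^ j := by
  have heigen : eulerOp (X ^ j : R[X]) = (j : R) • X ^ j := by
    rw [eulerOp_apply, derivative_X_pow, smul_eq_C_mul]
    rcases j with _ | j
    · simp
    · rw [Nat.add_sub_cancel, pow_succ]; ring
  induction s with
  | zero => simp
  | succ s ih => rw [pow_succ', Module.End.mul_apply, ih, map_smul, heigen, smul_smul, pow_succ]

theorem X_sub_C_pow_succ_dvd_iff {R : Type*} [Field R] [CharZero R] {c : R} (hc : c ≠ 0) (μ : ℕ)
    (f : R[X]) :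
    (X - C c) ^ (μ + 1) ∣ f ↔ f.eval c = 0 ∧ (X - C c) ^ μ ∣ eulerOp f := by
  have hcop : IsCoprime ((X - C c) ^ μ) X := by
    simpa using (isCoprime_X_sub_C_of_isUnit_sub (a := c) (b := 0) (by simpa using hc)).pow_left
  rw [eulerOp_apply, show (X - C c) ^ μ ∣ X * derivative f ↔ (X - C c) ^ μ ∣ derivative f from
    ⟨hcop.dvd_of_dvd_mul_left, (Dvd.dvd.mul_left · X)⟩]
  refine ⟨fun h => ⟨dvd_iff_isRoot.1 ((dvd_pow_self _ μ.succ_ne_zero).trans h),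
    by simpa using pow_sub_one_dvd_derivative_of_pow_dvd h⟩, fun ⟨hroot, h⟩ => ?_⟩
  by_cases hf : derivative f = 0
  · obtain ⟨b, rfl⟩ := natDegree_eq_zero.1 (derivative_eq_zero.1 hf)
    rw [eval_C] at hroot
    simp [hroot]
  · have hf0 : f ≠ 0 := fun h0 => hf (by simp [h0])
    have hpos := (rootMultiplicity_pos hf0).2 hroot
    rw [← le_rootMultiplicity_iff hf, derivative_rootMultiplicity_of_root hroot] at h
    rw [← le_rootMultiplicity_iff hf0]
    omega

theorem X_sub_C_pow_dvd_iff_eulerOp {R : Type*} [Field R] [CharZero R] {c : R} (hc : c ≠ 0) (μ : ℕ)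
    (f : R[X]) :
    (X - C c) ^ μ ∣ f ↔ ∀ s < μ, ((eulerOp ^ s) f).eval c = 0 := by
  induction μ generalizing f with
  | zero => simp
  | succ μ ih =>
    rw [X_sub_C_pow_succ_dvd_iff hc, ih, Nat.forall_lt_succ_left]
    simp only [pow_zero, Module.End.one_apply, pow_succ, Module.End.mul_apply]

theorem image_card_filter_lt {α : Type*} [LinearOrder α] (t : Finset α) :
    t.image (fun i => (t.filter (· < i)).card) = Finset.range t.card := by
  have hmono : StrictMonoOn (fun i => (t.filter (· < i)).card) t := fun i hi j _ hij =>
    Finset.card_lt_card <| (Finset.ssubset_iff_of_subset fun l => by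
      simpa using fun hl h => ⟨hl, h.trans hij⟩).2 ⟨i, by simpa using ⟨hi, hij⟩, by simp⟩
  refine Finset.eq_of_subset_of_card_le (fun x hx => ?_) ?_
  · obtain ⟨i, hi, rfl⟩ := Finset.mem_image.1 hx
    exact Finset.mem_range.2 (Finset.card_lt_card (Finset.filter_ssubset.2 ⟨i, hi, lt_irrefl i⟩))
  · rw [Finset.card_range, Finset.card_image_of_injOn hmono.injOn]

variable {r : ℕ} (κ : Fin r → ℂ)

/-- The number of earlier occurrences of the entry `κ i`. -/
def rank (i : Fin r) : ℕ :=
  (Finset.univ.filter fun l : Fin r => l < i ∧ κ l = κ i).card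

theorem forall_rank_iff {q : ℂ → ℕ → Prop} :
    (∀ i, q (κ i) (rank κ i)) ↔ ∀ c, ∀ s < (Finset.univ.filter (κ · = c)).card, q c s := by
  have hrank : ∀ c i, κ i = c →
      rank κ i = ((Finset.univ.filter (κ · = c)).filter (· < i)).card := by
    rintro _ i rfl
    simp only [rank, Finset.filter_filter, and_comm]
  refine ⟨fun h c s hs => ?_, fun h i => h _ _ ?_⟩
  · rw [← Finset.mem_range, ← image_card_filter_lt, Finset.mem_image] at hs
    obtain ⟨i, hi, rfl⟩ := hs
    obtain rfl := (Finset.mem_filter.1 hi).2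
    rw [← hrank _ i rfl]
    exact h i
  · rw [← Finset.mem_range, ← image_card_filter_lt, hrank _ i rfl]
    exact Finset.mem_image_of_mem _ (by simp)

/-- The linear forms whose values at `1, X, X ^ 2, …` are the columns of the basis matrix. -/
def confluentEval (i : Fin r) : ℂ[X] →ₗ[ℂ] ℂ :=
  leval (κ i) ∘ₗ eulerOp ^ rank κ i

theorem basisMatrix_apply (n : ℕ) (j : Fin n) (i : Fin r) :
    basisMatrix n κ j i = confluentEval κ i (X ^ (j : ℕ)) := by
  simp [confluentEval, eulerOp_pow_X_pow, basisMatrix, rank]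

theorem nodal_eq_multiset_prod {ι F : Type*} [Field F] (s : Finset ι) (v : ι → F) :
    Lagrange.nodal s v = ((s.val.map v).map fun x => X - C x).prod := by
  rw [Lagrange.nodal_eq, Multiset.map_map]
  rfl

theorem roots_nodal {ι F : Type*} [Field F] (s : Finset ι) (v : ι → F) :
    (Lagrange.nodal s v).roots = s.val.map v := by
  rw [nodal_eq_multiset_prod, roots_multiset_prod_X_sub_C]

theorem natDegree_nodal_univ : (Lagrange.nodal Finset.univ κ).natDegree = r := by
  rw [Lagrange.natDegree_nodal, Finset.card_fin]

variable {κ}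

theorem nodal_dvd_iff_confluentEval (h0 : ∀ i, κ i ≠ 0) (f : ℂ[X]) :
    Lagrange.nodal Finset.univ κ ∣ f ↔ ∀ i, confluentEval κ i f = 0 := by
  rcases eq_or_ne f 0 with rfl | hf
  · simp
  have hpow : ∀ c, (X - C c) ^ (Finset.univ.filter (κ · = c)).card ∣ f ↔
      ∀ s < (Finset.univ.filter (κ · = c)).card, ((eulerOp ^ s) f).eval c = 0 := by
    intro c
    rcases eq_or_ne c 0 with rfl | hc
    · simp [Finset.filter_false_of_mem fun i _ => h0 i]
    · exact X_sub_C_pow_dvd_iff_eulerOp hc _ f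
  calc Lagrange.nodal Finset.univ κ ∣ f
      ↔ ∀ c, (X - C c) ^ (Finset.univ.filter (κ · = c)).card ∣ f := by
        rw [nodal_eq_multiset_prod, Multiset.prod_X_sub_C_dvd_iff_le_roots hf,
          Multiset.le_iff_count]
        refine forall_congr' fun c => ?_
        rw [count_roots, le_rootMultiplicity_iff hf, Multiset.count_map, Finset.card_def,
          Finset.filter_val]
        simp only [eq_comm]
    _ ↔ ∀ i, ((eulerOp ^ rank κ i) f).eval (κ i) = 0 := by
        simp only [hpow, forall_rank_iff κ (q := fun c s => ((eulerOp ^ s) f).eval c = 0)]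

theorem det_basisMatrix_ne_zero (h0 : ∀ i, κ i ≠ 0) : (basisMatrix r κ).det ≠ 0 := by
  intro hdet
  obtain ⟨v, hv, hv0⟩ := Matrix.exists_vecMul_eq_zero_iff.2 hdet
  set f : ℂ[X] := ∑ j : Fin r, v j • X ^ (j : ℕ) with hf
  have hdvd : Lagrange.nodal Finset.univ κ ∣ f := by
    refine (nodal_dvd_iff_confluentEval h0 f).2 fun i => ?_
    simpa [hf, Matrix.vecMul, dotProduct, basisMatrix_apply] using congrFun hv0 i
  have hdeg : f.degree < (Lagrange.nodal Finset.univ κ).degree := by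
    simpa [hf, Lagrange.degree_nodal, smul_eq_C_mul] using degree_sum_fin_lt v
  have hfz : f = 0 := eq_zero_of_dvd_of_degree_lt hdvd hdeg
  refine hv (funext fun j => ?_)
  simpa [hf, coeff_X_pow, Fin.val_inj] using congrArg (coeff · j) hfz

/-- The matrix whose rows hold the coefficients of the remainders of `1, X, X ^ 2, …` modulo `S`. It
depends on the roots of `S` only through the coefficients of `S`. -/
def remainderMatrix (n r : ℕ) (S : ℂ[X]) : Matrix (Fin n) (Fin r) ℂ :=
  Matrix.of fun j i => (X ^ (j : ℕ) %ₘ S).coeff i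

theorem basisMatrix_eq_remainderMatrix_mul (h0 : ∀ i, κ i ≠ 0) (n : ℕ) :
    basisMatrix n κ = remainderMatrix n r (Lagrange.nodal Finset.univ κ) * basisMatrix r κ := by
  ext j i
  have hmonic : (Lagrange.nodal Finset.univ κ).Monic := Lagrange.nodal_monic
  have hdeg : (Lagrange.nodal Finset.univ κ).degree = r := by
    rw [Lagrange.degree_nodal, Finset.card_fin]
  generalize hS : Lagrange.nodal Finset.univ κ = S at *
  have hquot : confluentEval κ i (S * (X ^ (j : ℕ) /ₘ S)) = 0 :=
    (nodal_dvd_iff_confluentEval h0 _).1 (hS ▸ dvd_mul_right _ _) i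
  rw [basisMatrix_apply, ← modByMonic_add_div (X ^ (j : ℕ)) S, map_add, hquot, add_zero]
  conv_lhs => rw [← sum_modByMonic_coeff hmonic hdeg.le]
  simp only [map_sum, ← C_mul_X_pow_eq_monomial, ← smul_eq_C_mul, map_smul, smul_eq_mul,
    Matrix.mul_apply, basisMatrix_apply, remainderMatrix, Matrix.of_apply]

theorem det_basisMatrix_quotient {m : ℕ} (h0 : ∀ i, κ i ≠ 0) (z : ℂ)
    (A : Matrix (Fin r) (Fin m) ℂ) :
    (z • basisMatrix r κ - A * basisMatrix m κ).det / (basisMatrix r κ).det =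
      (z • (1 : Matrix (Fin r) (Fin r) ℂ) -
        A * remainderMatrix m r (Lagrange.nodal Finset.univ κ)).det := by
  rw [div_eq_iff (det_basisMatrix_ne_zero h0), ← Matrix.det_mul, Matrix.sub_mul,
    Matrix.smul_mul, Matrix.one_mul, Matrix.mul_assoc, ← basisMatrix_eq_remainderMatrix_mul h0]

end ConfluentVandermonde

section DiffContOnCl

variable {E : Type*} [NormedAddCommGroup E] [NormedSpace ℂ E] {U : Set E} {ι : Type*}

theorem diffContOnCl_finset_sum {f : ι → E → ℂ} (t : Finset ι)
    (hf : ∀ i ∈ t, DiffContOnCl ℂ (f i) U) : DiffContOnCl ℂ (fun x => ∑ i ∈ t, f i x) U :=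
  ⟨DifferentiableOn.fun_sum fun i hi => (hf i hi).differentiableOn,
    continuousOn_finsetSum t fun i hi => (hf i hi).continuousOn⟩

theorem diffContOnCl_finset_prod {f : ι → E → ℂ} (t : Finset ι)
    (hf : ∀ i ∈ t, DiffContOnCl ℂ (f i) U) : DiffContOnCl ℂ (fun x => ∏ i ∈ t, f i x) U := by
  classical
  induction t using Finset.induction_on with
  | empty => simpa using diffContOnCl_const
  | insert i t hi ih =>
    simp only [Finset.prod_insert hi]
    exact (hf i (Finset.mem_insert_self i t)).smul
      (ih fun k hk => hf k (Finset.mem_insert_of_mem hk))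

theorem diffContOnCl_det [Fintype ι] [DecidableEq ι] {M : E → Matrix ι ι ℂ}
    (hM : ∀ i j, DiffContOnCl ℂ (fun x => M x i j) U) :
    DiffContOnCl ℂ (fun x => (M x).det) U := by
  simp only [Matrix.det_apply]
  exact diffContOnCl_finset_sum _ fun σ _ =>
    (diffContOnCl_finset_prod _ fun i _ => hM (σ i) i).const_smul _

theorem coeff_X_pow_succ_modByMonic {R : Type*} [CommRing R] {S : R[X]} (hS : S.Monic) (j i : ℕ) :
    (X ^ (j + 1) %ₘ S).coeff i = (X * (X ^ j %ₘ S)).coeff i -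
      (X ^ j %ₘ S).coeff (S.natDegree - 1) * S.coeff i := by
  nontriviality R
  set g := X ^ j %ₘ S
  set b := g.coeff (S.natDegree - 1) with hb
  have hcoeff : ∀ m, S.natDegree ≤ m → g.coeff m = 0 := by
    rw [← degree_lt_iff_coeff_zero, ← degree_eq_natDegree hS.ne_zero]
    exact degree_modByMonic_lt _ hS
  have hdeg : (X * g - C b * S).degree < S.degree := by
    rw [degree_eq_natDegree hS.ne_zero, degree_lt_iff_coeff_zero]
    rintro (_ | m) hm
    · simp [hb, hcoeff 0 hm, Nat.le_zero.1 hm]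
    · rw [coeff_sub, coeff_X_mul, coeff_C_mul]
      rcases hm.eq_or_lt with hm | hm
      · rw [← hm, hS.coeff_natDegree, hb, hm, Nat.add_sub_cancel, mul_one, sub_self]
      · rw [hcoeff m (Nat.lt_succ_iff.1 hm), coeff_eq_zero_of_natDegree_lt hm, mul_zero, sub_zero]
  have hdiv : X * g - C b * S + S * (X * (X ^ j /ₘ S) + C b) = X ^ (j + 1) := by
    linear_combination X * modByMonic_add_div (X ^ j) S
  rw [(div_modByMonic_unique _ _ hS ⟨hdiv, hdeg⟩).2, coeff_sub, coeff_C_mul]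

theorem diffContOnCl_coeff_X_pow_modByMonic {S : E → ℂ[X]} {r : ℕ}
    (hmonic : ∀ x, (S x).Monic) (hdeg : ∀ x, (S x).natDegree = r)
    (hS : ∀ i, DiffContOnCl ℂ (fun x => (S x).coeff i) U) (j i : ℕ) :
    DiffContOnCl ℂ (fun x => (X ^ j %ₘ S x).coeff i) U := by
  induction j generalizing i with
  | zero =>
    rcases r.eq_zero_or_pos with rfl | hr
    · have hone : ∀ x, S x = 1 := fun x => (hmonic x).natDegree_eq_zero.1 (hdeg x)
      simpa [hone] using diffContOnCl_const
    · have hone : ∀ x, (1 : ℂ[X]) %ₘ S x = 1 := fun x =>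
        (modByMonic_eq_self_iff (hmonic x)).2 <| by
          rw [degree_one, degree_eq_natDegree (hmonic x).ne_zero, hdeg]
          exact_mod_cast hr
      simpa [hone] using diffContOnCl_const
  | succ j ih =>
    simp only [coeff_X_pow_succ_modByMonic (hmonic _), hdeg]
    refine DiffContOnCl.sub ?_ ((ih (r - 1)).smul (hS i))
    cases i with
    | zero => simpa using diffContOnCl_const
    | succ i => simpa using ih i

end DiffContOnCl

section CircleIntegrals

variable {c : ℂ} {R : ℝ}

theorem differentiableOn_circleIntegral {E : Type*} [NormedAddCommGroup E] [NormedSpace ℂ E]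
    {f f' : ℂ → ℂ → E} {U : Set ℂ} (hU : IsOpen U) (hR : 0 ≤ R)
    (hf : ∀ w ∈ U, ∀ x ∈ sphere c R, HasDerivAt (f · x) (f' w x) w)
    (hcont : ∀ w ∈ U, ContinuousOn (f w) (sphere c R))
    (hcont' : ContinuousOn (Function.uncurry f') (U ×ˢ sphere c R)) :
    DifferentiableOn ℂ (fun w => ∮ x in C(c, R), f w x) U := by
  intro w₀ hw₀
  obtain ⟨ε, hε, hεU⟩ := nhds_basis_closedBall.mem_iff.1 (hU.mem_nhds hw₀)
  have hcompact : IsCompact (closedBall w₀ ε ×ˢ sphere c R) :=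
    (isCompact_closedBall w₀ ε).prod (isCompact_sphere c R)
  obtain ⟨M, hM⟩ := hcompact.exists_bound_of_continuousOn
    (hcont'.mono (Set.prod_mono_left hεU))
  have hmem : ∀ θ, circleMap c R θ ∈ sphere c R := circleMap_mem_sphere c hR
  have hderiv : Continuous (deriv (circleMap c R)) := by
    rw [funext (deriv_circleMap c R)]
    fun_prop
  have hcont_param : ∀ {g : ℂ → E}, ContinuousOn g (sphere c R) →
      Continuous fun θ => deriv (circleMap c R) θ • g (circleMap c R θ) := fun hg =>
    hderiv.smul (hg.comp_continuous (continuous_circleMap c R) hmem)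
  have hcont₀ : ContinuousOn (f' w₀) (sphere c R) :=
    hcont'.comp (f := fun x => (w₀, x)) (by fun_prop) fun x hx => ⟨hw₀, hx⟩
  refine (intervalIntegral.hasDerivAt_integral_of_dominated_loc_of_deriv_le
    (F' := fun w θ => deriv (circleMap c R) θ • f' w (circleMap c R θ)) (bound := fun _ => |R| * M)
    (closedBall_mem_nhds w₀ hε) ?_ ((hcont_param (hcont w₀ hw₀)).intervalIntegrable _ _)
    (hcont_param hcont₀).aestronglyMeasurable ?_ intervalIntegrable_const
    ?_).2.differentiableAt.differentiableWithinAt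
  · filter_upwards [hU.mem_nhds hw₀] with w hw
    exact (hcont_param (hcont w hw)).aestronglyMeasurable
  · refine Filter.Eventually.of_forall fun θ _ w hw => ?_
    rw [norm_smul, deriv_circleMap, norm_mul, norm_circleMap_zero, Complex.norm_I, mul_one]
    exact mul_le_mul_of_nonneg_left (hM (w, _) ⟨hw, hmem θ⟩) (abs_nonneg R)
  · exact Filter.Eventually.of_forall fun θ _ w hw => (hf w (hεU hw) _ (hmem θ)).const_smul _

theorem circleIntegral_mul_one_div_sub {f : ℂ → ℂ} (hR : 0 ≤ R) (hf : DiffContOnCl ℂ f (ball c R))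
    {s : ℂ} (hs : s ∉ sphere c R) [Decidable (s ∈ ball c R)] :
    (∮ x in C(c, R), f x * (1 / (x - s))) =
      2 * Real.pi * Complex.I * if s ∈ ball c R then f s else 0 := by
  have hcomm : (fun x => f x * (1 / (x - s))) = fun x => (x - s)⁻¹ • f x :=
    funext fun x => by rw [one_div, smul_eq_mul, mul_comm]
  rw [hcomm]
  split_ifs with h
  · rw [hf.circleIntegral_sub_inv_smul h, smul_eq_mul]
  · have hne : ∀ x ∈ closure (ball c R), x - s ≠ 0 := fun x hx h0 => by
      have hx' := closure_ball_subset_closedBall hx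
      rw [sub_eq_zero.1 h0, ← ball_union_sphere] at hx'
      exact hx'.elim h hs
    rw [mul_zero]
    have hsub : DiffContOnCl ℂ (fun x => x - s) (ball c R) :=
      (differentiable_id.sub_const s).diffContOnCl
    exact ((hsub.inv hne).smul hf).circleIntegral_eq_zero hR

theorem circleIntegral_mul_sum_one_div_sub {f : ℂ → ℂ} (hR : 0 ≤ R)
    (hf : DiffContOnCl ℂ f (ball c R)) [DecidablePred (· ∈ ball c R)] {S : Multiset ℂ}
    (hS : ∀ s ∈ S, s ∉ sphere c R) :
    (∮ x in C(c, R), f x * (S.map fun s => 1 / (x - s)).sum) =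
      2 * Real.pi * Complex.I * ((S.filter (· ∈ ball c R)).map f).sum := by
  have hcont : ∀ s ∉ sphere c R, ContinuousOn (fun x => 1 / (x - s)) (sphere c R) := fun s hs =>
    continuousOn_const.div (by fun_prop) fun x hx h0 => hs (sub_eq_zero.1 h0 ▸ hx)
  have hfcont : ContinuousOn f (sphere c R) :=
    hf.continuousOn_ball.mono sphere_subset_closedBall
  induction S using Multiset.induction_on with
  | empty => simp [circleIntegral]
  | cons s S ih =>
    rw [Multiset.forall_mem_cons] at hS
    have hsum : ContinuousOn (fun x => (S.map fun s => 1 / (x - s)).sum) (sphere c R) :=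
      continuousOn_multiset_sum _ fun s hs => hcont s (hS.2 s hs)
    simp only [Multiset.map_cons, Multiset.sum_cons, mul_add]
    rw [circleIntegral.integral_add ((hfcont.fun_mul (hcont s hS.1)).circleIntegrable hR)
      ((hfcont.fun_mul hsum).circleIntegrable hR), ih hS.2,
      circleIntegral_mul_one_div_sub hR hf hS.1, Multiset.filter_cons]
    split_ifs <;> simp [mul_add]

theorem circleIntegral_mul_logDeriv {f : ℂ → ℂ} (hR : 0 ≤ R) (hf : DiffContOnCl ℂ f (ball c R))
    [DecidablePred (· ∈ ball c R)] {P : ℂ[X]} (hP : ∀ x ∈ sphere c R, P.eval x ≠ 0) :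
    (∮ x in C(c, R), f x * ((derivative P).eval x / P.eval x)) =
      2 * Real.pi * Complex.I * ((P.roots.filter (· ∈ ball c R)).map f).sum := by
  rw [← circleIntegral_mul_sum_one_div_sub hR hf fun s hs hs' => hP s hs' (isRoot_of_mem_roots hs)]
  refine circleIntegral.integral_congr hR fun x hx => ?_
  rw [(IsAlgClosed.splits P).eval_derivative_div_eval_of_ne_zero (hP x hx)]

end CircleIntegrals

section Newton

variable {ι : Type*} [Fintype ι]

theorem coeff_nodal_univ (κ : ι → ℂ) {i : ℕ} (hi : i ≤ Fintype.card ι) :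
    (Lagrange.nodal Finset.univ κ).coeff i = (-1) ^ (Fintype.card ι - i) *
      MvPolynomial.aeval κ (MvPolynomial.esymm ι ℂ (Fintype.card ι - i)) := by
  have hcard : (Finset.univ.val.map κ).card = Fintype.card ι := by simp
  rw [nodal_eq_multiset_prod, Multiset.prod_X_sub_C_coeff _ (hcard ▸ hi), hcard,
    MvPolynomial.aeval_esymm_eq_multiset_esymm]

theorem coeff_nodal_univ_of_lt (κ : ι → ℂ) {i : ℕ} (hi : Fintype.card ι < i) :
    (Lagrange.nodal Finset.univ κ).coeff i = 0 :=
  coeff_eq_zero_of_natDegree_lt (by rwa [Lagrange.natDegree_nodal, Finset.card_univ])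

theorem continuous_coeff_nodal_univ :
    Continuous fun κ : ι → ℂ => (Lagrange.nodal Finset.univ κ).coeff := by
  refine continuous_pi fun i => ?_
  rcases le_or_gt i (Fintype.card ι) with hi | hi
  · simp only [coeff_nodal_univ _ hi, MvPolynomial.aeval_eq_eval]
    exact continuous_const.mul (MvPolynomial.continuous_eval _)
  · simpa only [coeff_nodal_univ_of_lt _ hi] using continuous_const

variable {E : Type*} [NormedAddCommGroup E] [NormedSpace ℂ E] {U : Set E} {κ : E → ι → ℂ}

theorem differentiableOn_esymm (hκ : ∀ k, DifferentiableOn ℂ (fun x => ∑ i, κ x i ^ k) U) (k : ℕ) :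
    DifferentiableOn ℂ (fun x => MvPolynomial.aeval (κ x) (MvPolynomial.esymm ι ℂ k)) U := by
  classical
  induction k using Nat.strong_induction_on with
  | _ k ih =>
    rcases k.eq_zero_or_pos with rfl | hk
    · simp
    have hnewton : ∀ x, MvPolynomial.aeval (κ x) (MvPolynomial.esymm ι ℂ k) =
        (k : ℂ)⁻¹ * ((-1) ^ (k + 1) *
          ∑ b ∈ (Finset.HasAntidiagonal.antidiagonal k).filter (·.1 < k), (-1) ^ b.1 *
            MvPolynomial.aeval (κ x) (MvPolynomial.esymm ι ℂ b.1) * ∑ i, κ x i ^ b.2) := by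
      intro x
      rw [eq_inv_mul_iff_mul_eq₀ (by exact_mod_cast hk.ne')]
      simpa [MvPolynomial.psum] using
        congrArg (MvPolynomial.aeval (κ x)) (MvPolynomial.mul_esymm_eq_sum ι ℂ k)
    simp only [hnewton]
    exact ((DifferentiableOn.fun_sum fun b hb =>
      ((ih b.1 (Finset.mem_filter.1 hb).2).const_mul _).mul (hκ b.2)).const_mul _).const_mul _

theorem differentiableOn_coeff_nodal_univ
    (hκ : ∀ k, DifferentiableOn ℂ (fun x => ∑ i, κ x i ^ k) U) (i : ℕ) :
    DifferentiableOn ℂ (fun x => (Lagrange.nodal Finset.univ (κ x)).coeff i) U := by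
  rcases le_or_gt i (Fintype.card ι) with hi | hi
  · simp only [coeff_nodal_univ _ hi]
    exact (differentiableOn_esymm hκ _).const_mul _
  · simpa only [coeff_nodal_univ_of_lt _ hi] using differentiableOn_const _

end Newton

section InnerRoots

/-- The roots of a polynomial in the open unit disk, with multiplicity. -/
def innerRoots (P : ℂ[X]) : Multiset ℂ :=
  P.roots.filter fun x => ‖x‖ < 1

/-- The monic polynomial whose roots are the roots of `P` in the open unit disk. -/
def innerPoly (P : ℂ[X]) : ℂ[X] :=
  ((innerRoots P).map fun x => X - C x).prod

theorem innerRoots_C_mul {b : ℂ} (hb : b ≠ 0) (P : ℂ[X]) : innerRoots (C b * P) = innerRoots P := by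
  rw [innerRoots, roots_C_mul P hb, innerRoots]

theorem innerRoots_X_pow (n : ℕ) : innerRoots (X ^ n) = Multiset.replicate n 0 := by
  rw [innerRoots, roots_X_pow, Multiset.nsmul_singleton,
    Multiset.filter_eq_self.2 fun x hx => by simp [Multiset.eq_of_mem_replicate hx]]

theorem nodal_univ_eq_innerPoly_iff {ι : Type*} [Fintype ι] {κ : ι → ℂ} {P : ℂ[X]} :
    Lagrange.nodal Finset.univ κ = innerPoly P ↔ Finset.univ.val.map κ = innerRoots P := by
  refine ⟨fun h => ?_, fun h => by rw [nodal_eq_multiset_prod, h, innerPoly]⟩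
  rw [← roots_nodal, h, innerPoly, roots_multiset_prod_X_sub_C]

theorem exists_map_univ_eq {α : Type*} {n : ℕ} {S : Multiset α} (hS : S.card = n) :
    ∃ v : Fin n → α, Finset.univ.val.map v = S := by
  obtain ⟨l, rfl⟩ := Quot.exists_rep S
  obtain rfl : l.length = n := hS
  exact ⟨l.get, by rw [Fin.univ_val_map, List.ofFn_get]; rfl⟩

theorem circleIntegral_pow_mul_logDeriv {P : ℂ[X]} (hP : ∀ x, ‖x‖ = 1 → P.eval x ≠ 0) (k : ℕ) :
    (∮ x in C(0, 1), x ^ k * ((derivative P).eval x / P.eval x)) =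
      2 * Real.pi * Complex.I * ((innerRoots P).map (· ^ k)).sum := by
  classical
  have hpow : DiffContOnCl ℂ (fun x : ℂ => x ^ k) (ball 0 1) :=
    (differentiable_id.pow k).diffContOnCl
  rw [circleIntegral_mul_logDeriv zero_le_one hpow fun x hx => hP x (by simpa using hx)]
  simp only [innerRoots, mem_ball_zero_iff]

variable {F Q : ℂ[X]} (hF : ∀ x, ‖x‖ = 1 → F.eval x ≠ 0)
  (hQ : ∀ x, ‖x‖ = 1 → ‖Q.eval x‖ ≤ ‖F.eval x‖)
include hF hQ

theorem eval_sub_C_mul_ne_zero {ζ : ℂ} (hζ : ‖ζ‖ < 1) {x : ℂ} (hx : ‖x‖ = 1) :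
    (F - C ζ * Q).eval x ≠ 0 := by
  intro h
  rw [eval_sub, eval_mul, eval_C, sub_eq_zero] at h
  have hpos : 0 < ‖F.eval x‖ := norm_pos_iff.2 (hF x hx)
  have hle : ‖F.eval x‖ ≤ ‖ζ‖ * ‖F.eval x‖ := calc
    ‖F.eval x‖ = ‖ζ‖ * ‖Q.eval x‖ := by rw [← norm_mul, ← h]
    _ ≤ ‖ζ‖ * ‖F.eval x‖ := by gcongr; exact hQ x hx
  nlinarith

theorem differentiableOn_innerRoots_powerSum (k : ℕ) :
    DifferentiableOn ℂ (fun ζ => ((innerRoots (F - C ζ * Q)).map (· ^ k)).sum) (ball 0 1) := by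
  have hne : ∀ ζ ∈ ball (0 : ℂ) 1, ∀ x ∈ sphere (0 : ℂ) 1, F.eval x - ζ * Q.eval x ≠ 0 :=
    fun ζ hζ x hx => by
      simpa using eval_sub_C_mul_ne_zero hF hQ (by simpa using hζ) (by simpa using hx)
  have hint : DifferentiableOn ℂ (fun ζ => ∮ x in C(0, 1), x ^ k *
      (((derivative F).eval x - ζ * (derivative Q).eval x) / (F.eval x - ζ * Q.eval x)))
      (ball 0 1) := by
    refine differentiableOn_circleIntegral (f' := fun ζ x => x ^ k *
      ((-(derivative Q).eval x * (F.eval x - ζ * Q.eval x) -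
        ((derivative F).eval x - ζ * (derivative Q).eval x) * -Q.eval x) /
          (F.eval x - ζ * Q.eval x) ^ 2)) isOpen_ball zero_le_one ?_ ?_ ?_
    · intro ζ hζ x hx
      have haff : ∀ b d : ℂ, HasDerivAt (fun ζ => b - ζ * d) (-d) ζ := fun b d => by
        simpa using ((hasDerivAt_id ζ).mul_const d).const_sub b
      exact ((haff _ _).div (haff _ _) (hne ζ hζ x hx)).const_mul _
    · exact fun ζ hζ => (continuousOn_id.pow k).mul <|
        ContinuousOn.div (by fun_prop) (by fun_prop) (hne ζ hζ)
    · refine ContinuousOn.mul (by fun_prop) <|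
        ContinuousOn.div (by fun_prop) (by fun_prop) ?_
      rintro ⟨ζ, x⟩ ⟨hζ, hx⟩
      exact pow_ne_zero 2 (hne ζ hζ x hx)
  refine (hint.const_mul (2 * Real.pi * Complex.I)⁻¹).congr fun ζ hζ => ?_
  rw [eq_inv_mul_iff_mul_eq₀ Complex.two_pi_I_ne_zero, ← circleIntegral_pow_mul_logDeriv
    fun x hx => eval_sub_C_mul_ne_zero hF hQ (by simpa using hζ) hx]
  simp

theorem card_innerRoots_sub_C_mul {ζ : ℂ} (hζ : ‖ζ‖ < 1) :
    (innerRoots (F - C ζ * Q)).card = (innerRoots F).card := by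
  have hcont : ContinuousOn (fun ζ => (innerRoots (F - C ζ * Q)).card) (ball 0 1) := by
    rw [Nat.isClosedEmbedding_coe_real.isInducing.continuousOn_iff]
    refine (Complex.continuous_re.comp_continuousOn
      (differentiableOn_innerRoots_powerSum hF hQ 0).continuousOn).congr fun ζ _ => ?_
    simp
  simpa using (convex_ball (0 : ℂ) 1).isPreconnected.constant hcont (by simpa using hζ)
    (mem_ball_self one_pos)

theorem exists_map_univ_eq_innerRoots {r : ℕ} (hr : (innerRoots F).card = r) {ζ : ℂ}
    (hζ : ‖ζ‖ < 1) : ∃ κ : Fin r → ℂ, Finset.univ.val.map κ = innerRoots (F - C ζ * Q) :=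
  exists_map_univ_eq ((card_innerRoots_sub_C_mul hF hQ hζ).trans hr)

theorem differentiableOn_coeff_innerPoly (i : ℕ) :
    DifferentiableOn ℂ (fun ζ => (innerPoly (F - C ζ * Q)).coeff i) (ball 0 1) := by
  obtain ⟨r, hr⟩ : ∃ r, (innerRoots F).card = r := ⟨_, rfl⟩
  have hex : ∀ ζ, ∃ κ : Fin r → ℂ, ‖ζ‖ < 1 →
      Finset.univ.val.map κ = innerRoots (F - C ζ * Q) := fun ζ => by
    by_cases hζ : ‖ζ‖ < 1
    · exact (exists_map_univ_eq_innerRoots hF hQ hr hζ).imp fun κ hκ _ => hκ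
    · exact ⟨0, fun h => absurd h hζ⟩
  choose κ hκ using hex
  have hpow : ∀ k, DifferentiableOn ℂ (fun ζ => ∑ i, κ ζ i ^ k) (ball 0 1) := fun k =>
    (differentiableOn_innerRoots_powerSum hF hQ k).congr fun ζ hζ => by
      rw [← hκ ζ (by simpa using hζ), Multiset.map_map]
      rfl
  refine (differentiableOn_coeff_nodal_univ hpow i).congr fun ζ hζ => ?_
  rw [nodal_univ_eq_innerPoly_iff.2 (hκ ζ (by simpa using hζ))]

end InnerRoots

section Limits

theorem exists_tendsto_of_finite_of_isPreconnected {α Y : Type*} [TopologicalSpace Y] [T2Space Y]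
    {l : Filter α} [l.NeBot] {f : α → Y} {T : Set Y} (hT : T.Finite)
    (hconn : ∀ s ∈ l, ∃ N ∈ l, N ⊆ s ∧ IsPreconnected (f '' N))
    (hcl : ∀ u : Ultrafilter α, (u : Filter α) ≤ l → ∃ t ∈ T, Tendsto f u (𝓝 t)) :
    ∃ t ∈ T, Tendsto f l (𝓝 t) := by
  obtain ⟨U, hU, hdisj⟩ := hT.t2_separation
  have hcover : {x | ∃ t ∈ T, f x ∈ U t} ∈ l := mem_iff_ultrafilter.2 fun u hu => by
    obtain ⟨t, ht, htend⟩ := hcl u hu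
    exact mem_of_superset (htend ((hU t).2.mem_nhds (hU t).1)) fun x hx => ⟨t, ht, hx⟩
  obtain ⟨N, hN, hNs, hNc⟩ := hconn _ hcover
  obtain ⟨t₀, ht₀, htend₀⟩ := hcl (Ultrafilter.of l) (Ultrafilter.of_le l)
  -- a connected set covered by the pairwise disjoint `U t` lies in one of them
  have hsub : f '' N ⊆ U t₀ := by
    obtain ⟨x₀, hx₀U, hx₀N⟩ := ((htend₀.eventually_mem ((hU t₀).2.mem_nhds (hU t₀).1)).and
      (Ultrafilter.of_le l hN)).exists
    refine hNc.subset_left_of_subset_union (v := ⋃ t ∈ T \ {t₀}, U t) (hU t₀).2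
      (isOpen_biUnion fun t _ => (hU t).2) ?_ ?_ ⟨f x₀, ⟨x₀, hx₀N, rfl⟩, hx₀U⟩
    · rw [Set.disjoint_iUnion₂_right]
      exact fun t ht => hdisj ht₀ ht.1 (Ne.symm ht.2)
    · rintro _ ⟨x, hx, rfl⟩
      obtain ⟨t, ht, hft⟩ := hNs hx
      rcases eq_or_ne t t₀ with rfl | h
      · exact Or.inl hft
      · exact Or.inr (Set.mem_biUnion (⟨ht, h⟩ : t ∈ T \ {t₀}) hft)
  refine ⟨t₀, ht₀, (tendsto_iff_ultrafilter f l _).2 fun u hu => ?_⟩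
  obtain ⟨t, ht, htend⟩ := hcl u hu
  obtain ⟨x, hxU, hxN⟩ := ((htend.eventually_mem ((hU t).2.mem_nhds (hU t).1)).and (hu hN)).exists
  obtain rfl : t = t₀ := by
    by_contra h
    exact Set.disjoint_left.1 (hdisj ht ht₀ h) hxU (hsub ⟨x, hxN, rfl⟩)
  exact htend

variable {α ι : Type*} [Fintype ι] {l : Filter α} {κ : α → ι → ℂ} {M : ℝ}

theorem exists_tendsto_of_ultrafilter_le (hM : ∀ᶠ x in l, ‖κ x‖ ≤ M) (u : Ultrafilter α)
    (hu : (u : Filter α) ≤ l) : ∃ κ₀, Tendsto κ u (𝓝 κ₀) := by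
  obtain ⟨κ₀, -, hκ₀⟩ := (isCompact_closedBall (0 : ι → ℂ) M).ultrafilter_le_nhds (u.map κ) <| by
    rw [le_principal_iff, Ultrafilter.coe_map, mem_map]
    filter_upwards [hu hM] with x hx
    simpa using hx
  exact ⟨κ₀, hκ₀⟩

theorem exists_tendsto_coeff_nodal [TopologicalSpace α] [l.NeBot] {x₀ : α} (hl : l ≤ 𝓝 x₀)
    {Φ : α → ℂ → ℂ} (hΦ : Continuous (Function.uncurry Φ)) (hfin : {y | Φ x₀ y = 0}.Finite)
    (hM : ∀ᶠ x in l, ‖κ x‖ ≤ M) (hκ : ∀ᶠ x in l, ∀ i, Φ x (κ x i) = 0)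
    (hconn : ∀ s ∈ l, ∃ N ∈ l, N ⊆ s ∧
      IsPreconnected ((fun x => (Lagrange.nodal Finset.univ (κ x)).coeff) '' N)) :
    ∃ κ₀ : ι → ℂ, (∀ i, Φ x₀ (κ₀ i) = 0) ∧
      Tendsto (fun x => (Lagrange.nodal Finset.univ (κ x)).coeff) l
        (𝓝 (Lagrange.nodal Finset.univ κ₀).coeff) := by
  have hfin' : {κ₀ : ι → ℂ | ∀ i, Φ x₀ (κ₀ i) = 0}.Finite := Set.Finite.pi' fun _ => hfin
  obtain ⟨_, ⟨κ₀, hzero, rfl⟩, htend⟩ := exists_tendsto_of_finite_of_isPreconnected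
    (hfin'.image fun κ₀ : ι → ℂ => (Lagrange.nodal Finset.univ κ₀).coeff) hconn fun u hu => by
      obtain ⟨κ₀, hκ₀⟩ := exists_tendsto_of_ultrafilter_le hM u hu
      refine ⟨_, ⟨κ₀, fun i => ?_, rfl⟩, (continuous_coeff_nodal_univ.tendsto κ₀).comp hκ₀⟩
      have hlim : Tendsto (fun x => Φ x (κ x i)) u (𝓝 (Φ x₀ (κ₀ i))) :=
        (hΦ.tendsto (x₀, κ₀ i)).comp
          ((tendsto_id'.2 (hu.trans hl)).prodMk_nhds (tendsto_pi_nhds.1 hκ₀ i))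
      exact tendsto_nhds_unique hlim (tendsto_const_nhds.congr'
        ((hκ.filter_mono hu).mono fun x hx => (hx i).symm))
  exact ⟨κ₀, hzero, htend⟩

theorem exists_perm_of_nodal_eq {κ κ' : ι → ℂ}
    (h : Lagrange.nodal Finset.univ κ = Lagrange.nodal Finset.univ κ') :
    ∃ σ : Equiv.Perm ι, κ' ∘ σ = κ := by
  classical
  have hfiber : ∀ c, Nonempty ({i // κ i = c} ≃ {i // κ' i = c}) := fun c => by
    have hmap := congrArg (Multiset.count c) (congrArg roots h)
    rw [roots_nodal, roots_nodal, Multiset.count_map, Multiset.count_map] at hmap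
    rw [← Fintype.card_eq, Fintype.card_subtype, Fintype.card_subtype]
    simpa only [eq_comm, Finset.card_def, Finset.filter_val] using hmap
  exact ⟨Equiv.ofFiberEquiv fun c => (hfiber c).some, funext fun i => Equiv.ofFiberEquiv_map _ i⟩

theorem eventually_exists_perm_norm_sub_lt {κ₀ : ι → ℂ} (hM : ∀ᶠ x in l, ‖κ x‖ ≤ M)
    (hκ : Tendsto (fun x => (Lagrange.nodal Finset.univ (κ x)).coeff) l
      (𝓝 (Lagrange.nodal Finset.univ κ₀).coeff)) {ε : ℝ} (hε : 0 < ε) :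
    ∀ᶠ x in l, ∃ σ : Equiv.Perm ι, ‖κ x ∘ σ - κ₀‖ < ε := by
  refine mem_iff_ultrafilter.2 fun u hu => ?_
  obtain ⟨κ₁, hκ₁⟩ := exists_tendsto_of_ultrafilter_le hM u hu
  have hnodal : Lagrange.nodal Finset.univ κ₀ = Lagrange.nodal Finset.univ κ₁ :=
    coeff_injective <| tendsto_nhds_unique (hκ.mono_left hu)
      ((continuous_coeff_nodal_univ.tendsto κ₁).comp hκ₁)
  obtain ⟨σ, rfl⟩ := exists_perm_of_nodal_eq hnodal
  have hperm : Tendsto (fun x => κ x ∘ σ) u (𝓝 (κ₁ ∘ σ)) :=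
    tendsto_pi_nhds.2 fun i => tendsto_pi_nhds.1 hκ₁ (σ i)
  filter_upwards [hperm (ball_mem_nhds _ hε)] with x hx
  exact ⟨σ, mem_ball_iff_norm.1 hx⟩

end Limits

section InnerPolyLimits

theorem norm_lt_one_of_map_eq_innerRoots {ι : Type*} [Fintype ι] {κ : ι → ℂ} {P : ℂ[X]}
    (hκ : Finset.univ.val.map κ = innerRoots P) : ‖κ‖ < 1 := by
  refine (pi_norm_lt_iff one_pos).2 fun i => ?_
  have hi : κ i ∈ innerRoots P := hκ ▸ Multiset.mem_map_of_mem κ (Finset.mem_univ i)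
  exact (Multiset.mem_filter.1 hi).2

theorem eval_eq_zero_of_map_eq_innerRoots {ι : Type*} [Fintype ι] {κ : ι → ℂ} {P : ℂ[X]}
    (hκ : Finset.univ.val.map κ = innerRoots P) (i : ι) : P.eval (κ i) = 0 := by
  have hi : κ i ∈ innerRoots P := hκ ▸ Multiset.mem_map_of_mem κ (Finset.mem_univ i)
  exact isRoot_of_mem_roots (Multiset.mem_filter.1 hi).1

theorem tendsto_coeff_innerPoly_iff {α : Type*} {l : Filter α} {r : ℕ} {P : α → ℂ[X]}
    (hP : ∀ᶠ x in l, ∃ κ : Fin r → ℂ, Finset.univ.val.map κ = innerRoots (P x)) {κ₀ : Fin r → ℂ} :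
    Tendsto (fun x => (innerPoly (P x)).coeff) l (𝓝 (Lagrange.nodal Finset.univ κ₀).coeff) ↔
      ∀ ε > 0, ∀ᶠ x in l, ∃ κ : Fin r → ℂ,
        Finset.univ.val.map κ = innerRoots (P x) ∧ ‖κ - κ₀‖ < ε := by
  constructor
  · intro h ε hε
    choose! κ hκ' using fun x (hx : ∃ κ : Fin r → ℂ, Finset.univ.val.map κ = innerRoots (P x)) => hx
    have hκ := hP.mono hκ'
    have hnodal : (fun x => (Lagrange.nodal Finset.univ (κ x)).coeff) =ᶠ[l]
        fun x => (innerPoly (P x)).coeff :=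
      hκ.mono fun x hx => congrArg coeff (nodal_univ_eq_innerPoly_iff.2 hx)
    filter_upwards [hκ, eventually_exists_perm_norm_sub_lt
      (hκ.mono fun x hx => (norm_lt_one_of_map_eq_innerRoots hx).le) (h.congr' hnodal.symm) hε]
      with x hx ⟨σ, hσ⟩
    exact ⟨κ x ∘ σ, by rw [← Multiset.map_map, Multiset.map_univ_val_equiv, hx], hσ⟩
  · intro h V hV
    obtain ⟨ε, hε, hball⟩ :=
      Metric.mem_nhds_iff.1 (continuous_coeff_nodal_univ.continuousAt (x := κ₀) hV)
    refine mem_map.2 ?_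
    filter_upwards [h ε hε] with x ⟨κ, hκ, hclose⟩
    rw [Set.mem_preimage, ← nodal_univ_eq_innerPoly_iff.2 hκ]
    exact hball (mem_ball_iff_norm.2 hclose)

theorem exists_tendsto_coeff_innerPoly {F Q : ℂ[X]} (hF : ∀ x, ‖x‖ = 1 → F.eval x ≠ 0)
    (hQ : ∀ x, ‖x‖ = 1 → ‖Q.eval x‖ ≤ ‖F.eval x‖) {r : ℕ} (hr : (innerRoots F).card = r) {ζ₀ : ℂ}
    (hζ₀ : ζ₀ ∈ closedBall (0 : ℂ) 1) (hne : F - C ζ₀ * Q ≠ 0) :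
    ∃ κ₀ : Fin r → ℂ, (∀ i, (F - C ζ₀ * Q).eval (κ₀ i) = 0) ∧
      Tendsto (fun ζ => (innerPoly (F - C ζ * Q)).coeff) (𝓝[ball 0 1] ζ₀)
        (𝓝 (Lagrange.nodal Finset.univ κ₀).coeff) := by
  have hbot : (𝓝[ball 0 1] ζ₀).NeBot := by
    rwa [← mem_closure_iff_nhdsWithin_neBot, closure_ball (0 : ℂ) one_ne_zero]
  have hball : ∀ᶠ ζ in 𝓝[ball 0 1] ζ₀, ‖ζ‖ < 1 :=
    eventually_nhdsWithin_of_forall fun ζ hζ => by simpa using hζ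
  obtain ⟨κ, hκ⟩ := (hball.mono fun ζ hζ => exists_map_univ_eq_innerRoots hF hQ hr hζ).choice
  have hnodal : (fun ζ => (Lagrange.nodal Finset.univ (κ ζ)).coeff) =ᶠ[𝓝[ball 0 1] ζ₀]
      fun ζ => (innerPoly (F - C ζ * Q)).coeff :=
    hκ.mono fun x hx => congrArg coeff (nodal_univ_eq_innerPoly_iff.2 hx)
  have hcont : Continuous (Function.uncurry fun ζ x => (F - C ζ * Q).eval x) := by
    simp only [eval_sub, eval_mul, eval_C]
    fun_prop
  have hfin : {x | (F - C ζ₀ * Q).eval x = 0}.Finite :=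
    (F - C ζ₀ * Q).roots.toFinset.finite_toSet.subset fun x hx => by simpa [hne] using hx
  have hconn : ∀ s ∈ 𝓝[ball 0 1] ζ₀, ∃ N ∈ 𝓝[ball 0 1] ζ₀, N ⊆ s ∧
      IsPreconnected ((fun ζ => (Lagrange.nodal Finset.univ (κ ζ)).coeff) '' N) := by
    intro s hs
    obtain ⟨ε, hε, hεs⟩ := mem_nhdsWithin_iff.1 (inter_mem hs hnodal)
    refine ⟨ball ζ₀ ε ∩ ball 0 1, inter_mem (mem_nhdsWithin_of_mem_nhds (ball_mem_nhds _ hε))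
      self_mem_nhdsWithin, fun ζ hζ => (hεs hζ).1, ?_⟩
    rw [Set.image_congr fun ζ hζ => (hεs hζ).2]
    exact ((convex_ball ζ₀ ε).inter (convex_ball 0 1)).isPreconnected.image _ <|
      (continuousOn_pi.2 fun i =>
        (differentiableOn_coeff_innerPoly hF hQ i).continuousOn).mono Set.inter_subset_right
  obtain ⟨κ₀, hzero, hκ₀⟩ := exists_tendsto_coeff_nodal nhdsWithin_le_nhds hcont hfin
    (hκ.mono fun ζ hζ => (norm_lt_one_of_map_eq_innerRoots hζ).le)
    (hκ.mono fun ζ hζ => eval_eq_zero_of_map_eq_innerRoots hζ) hconn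
  exact ⟨κ₀, hzero, hκ₀.congr' hnodal⟩

end InnerPolyLimits

section CharPoly

variable {r p : ℕ} {a : ℤ → ℂ}

theorem charPoly_eq_sub (z : ℂ) : charPoly r p a z = charPoly r p a 0 - C z * X ^ r := by
  simp only [charPoly, map_zero, zero_mul, sub_zero]

theorem coeff_zero_charPoly (hr : 1 ≤ r) (z : ℂ) : (charPoly r p a z).coeff 0 = a (-(r : ℤ)) := by
  simp [charPoly, coeff_zero_eq_eval_zero, eval_finsetSum, Finset.sum_range_succ', Nat.ne_of_gt hr]

theorem symbol_eq_sum_range (ξ : ℝ) :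
    symbol r p a ξ = ∑ l ∈ Finset.range (r + p + 1),
      a (l - r) * Complex.exp (Complex.I * ((l : ℂ) - r) * ξ) := by
  refine Finset.sum_nbij' (fun k => (k + r).toNat) (fun l => (l : ℤ) - r) ?_ ?_ ?_ ?_ ?_
  · intro k hk
    rw [Finset.mem_Icc] at hk
    rw [Finset.mem_range]
    omega
  · intro l hl
    rw [Finset.mem_range] at hl
    rw [Finset.mem_Icc]
    omega
  · intro k hk
    rw [Finset.mem_Icc] at hk
    omega
  · intro l _
    omega
  · intro k hk
    rw [Finset.mem_Icc] at hk
    obtain ⟨l, rfl⟩ : ∃ l : ℕ, k = l - r := ⟨(k + r).toNat, by omega⟩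
    simp

theorem eval_charPoly_exp (ξ : ℝ) :
    (charPoly r p a 0).eval (Complex.exp (Complex.I * ξ)) =
      Complex.exp (Complex.I * ξ) ^ r * symbol r p a ξ := by
  rw [symbol_eq_sum_range, Finset.mul_sum, charPoly]
  simp only [map_zero, zero_mul, sub_zero, eval_finsetSum, eval_mul, eval_C, eval_pow, eval_X]
  refine Finset.sum_congr rfl fun l _ => ?_
  rw [mul_left_comm, ← Complex.exp_nat_mul, ← Complex.exp_nat_mul, ← Complex.exp_add]
  ring_nf

theorem CauchyStable.norm_eval_le (hstab : CauchyStable r p a) {x : ℂ} (hx : ‖x‖ = 1) :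
    ‖(charPoly r p a 0).eval x‖ ≤ 1 := by
  obtain ⟨ξ, rfl⟩ : ∃ ξ : ℝ, Complex.exp (Complex.I * ξ) = x := by
    simpa only [mul_comm] using (Complex.norm_eq_one_iff x).1 hx
  rw [eval_charPoly_exp, norm_mul, norm_pow, hx, one_pow, one_mul]
  exact hstab ξ

end CharPoly

section ReciprocalPoly

/-- The polynomial `κ ^ r - ζ ∑_{k=-r}^p a_k κ^{r+k} = -ζ P_{1/ζ}(κ)`: the characteristic equation
in the variable `ζ = 1 / z`, in which the point at infinity of the `z`-plane becomes `ζ = 0`. -/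
def reciprocalPoly (r p : ℕ) (a : ℤ → ℂ) (ζ : ℂ) : ℂ[X] :=
  X ^ r - C ζ * charPoly r p a 0

variable {r p : ℕ} {a : ℤ → ℂ} {z ζ : ℂ} {κ : Fin r → ℂ}

theorem charPoly_eq_C_mul_reciprocalPoly (hz : z ≠ 0) :
    charPoly r p a z = C (-z) * reciprocalPoly r p a z⁻¹ := by
  rw [charPoly_eq_sub, reciprocalPoly, mul_sub, ← mul_assoc, ← C_mul, neg_mul, mul_inv_cancel₀ hz]
  simp only [map_neg, map_one]
  ring

theorem enumeratesInnerRoots_iff (hz : z ≠ 0) :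
    EnumeratesInnerRoots r p a z κ ↔
      Finset.univ.val.map κ = innerRoots (reciprocalPoly r p a z⁻¹) := by
  rw [← innerRoots_C_mul (neg_ne_zero.2 hz), ← charPoly_eq_C_mul_reciprocalPoly hz]
  rfl

theorem coeff_zero_reciprocalPoly (hr : 1 ≤ r) :
    (reciprocalPoly r p a ζ).coeff 0 = -ζ * a (-(r : ℤ)) := by
  simp [reciprocalPoly, coeff_zero_charPoly hr, coeff_X_pow, Nat.ne_of_lt hr]

theorem ne_zero_of_eval_reciprocalPoly_eq_zero (hr : 1 ≤ r) (har : a (-(r : ℤ)) ≠ 0) (hζ : ζ ≠ 0)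
    {x : ℂ} (hx : (reciprocalPoly r p a ζ).eval x = 0) : x ≠ 0 := by
  rintro rfl
  rw [← coeff_zero_eq_eval_zero, coeff_zero_reciprocalPoly hr] at hx
  exact mul_ne_zero (neg_ne_zero.2 hζ) har hx

theorem eval_X_pow_ne_zero {x : ℂ} (hx : ‖x‖ = 1) : (X ^ r : ℂ[X]).eval x ≠ 0 := by
  rw [eval_pow, eval_X]
  exact pow_ne_zero r (norm_ne_zero_iff.1 (hx ▸ one_ne_zero))

theorem card_innerRoots_X_pow : (innerRoots (X ^ r)).card = r := by
  rw [innerRoots_X_pow, Multiset.card_replicate]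

namespace CauchyStable

variable (hstab : CauchyStable r p a)
include hstab

theorem norm_eval_le_norm_eval_X_pow {x : ℂ} (hx : ‖x‖ = 1) :
    ‖(charPoly r p a 0).eval x‖ ≤ ‖(X ^ r : ℂ[X]).eval x‖ := by
  simpa [hx] using hstab.norm_eval_le hx

theorem exists_map_univ_eq_innerRoots (hζ : ‖ζ‖ < 1) :
    ∃ κ : Fin r → ℂ, Finset.univ.val.map κ = innerRoots (reciprocalPoly r p a ζ) :=
  KreissLopatinskii.exists_map_univ_eq_innerRoots (fun _ => eval_X_pow_ne_zero)
    (fun _ => hstab.norm_eval_le_norm_eval_X_pow) card_innerRoots_X_pow hζ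

theorem differentiableOn_coeff_innerPoly (i : ℕ) :
    DifferentiableOn ℂ (fun ζ => (innerPoly (reciprocalPoly r p a ζ)).coeff i) (ball 0 1) :=
  KreissLopatinskii.differentiableOn_coeff_innerPoly (fun _ => eval_X_pow_ne_zero)
    (fun _ => hstab.norm_eval_le_norm_eval_X_pow) i

theorem exists_tendsto_coeff_innerPoly (hr : 1 ≤ r) (har : a (-(r : ℤ)) ≠ 0) (hζ0 : ζ ≠ 0)
    (hζ : ‖ζ‖ ≤ 1) :
    ∃ κ₀ : Fin r → ℂ, (∀ i, κ₀ i ≠ 0) ∧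
      Tendsto (fun ζ => (innerPoly (reciprocalPoly r p a ζ)).coeff) (𝓝[ball 0 1] ζ)
        (𝓝 (Lagrange.nodal Finset.univ κ₀).coeff) := by
  have hne : reciprocalPoly r p a ζ ≠ 0 := fun h => by
    have h0 := coeff_zero_reciprocalPoly (p := p) (a := a) (ζ := ζ) hr
    rw [h, coeff_zero, eq_comm] at h0
    exact mul_ne_zero (neg_ne_zero.2 hζ0) har h0
  obtain ⟨κ₀, hroot, hκ₀⟩ := KreissLopatinskii.exists_tendsto_coeff_innerPoly
    (fun _ => eval_X_pow_ne_zero) (fun _ => hstab.norm_eval_le_norm_eval_X_pow)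
    card_innerRoots_X_pow (mem_closedBall_zero_iff.2 hζ) hne
  exact ⟨κ₀, fun i => ne_zero_of_eval_reciprocalPoly_eq_zero hr har hζ0 (hroot i), hκ₀⟩

end CauchyStable

end ReciprocalPoly

section StableRoots

variable {r p : ℕ} {a : ℤ → ℂ} {z ζ : ℂ} {κ : Fin r → ℂ}

theorem map_inv_nhdsWithin_one_lt_norm (hz : z ≠ 0) :
    Filter.map Inv.inv (𝓝[{w : ℂ | 1 < ‖w‖}] z) = 𝓝[ball 0 1] z⁻¹ := by
  have hmaps : ∀ w ∈ ball (0 : ℂ) 1, w ≠ 0 → w⁻¹ ∈ {w : ℂ | 1 < ‖w‖} := fun w hw hw0 => by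
    rw [Set.mem_ofPred_eq, norm_inv]
    exact (one_lt_inv₀ (norm_pos_iff.2 hw0)).2 (mem_ball_zero_iff.1 hw)
  refine le_antisymm (tendsto_nhdsWithin_iff.2 ⟨?_, ?_⟩) ?_
  · exact (continuousAt_inv₀ hz).tendsto.mono_left nhdsWithin_le_nhds
  · filter_upwards [self_mem_nhdsWithin] with w hw
    rw [mem_ball_zero_iff, norm_inv]
    exact inv_lt_one_of_one_lt₀ hw
  · have hinv : Tendsto Inv.inv (𝓝[ball 0 1] z⁻¹) (𝓝[{w : ℂ | 1 < ‖w‖}] z) := by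
      refine tendsto_nhdsWithin_iff.2 ⟨?_, ?_⟩
      · simpa using (continuousAt_inv₀ (inv_ne_zero hz)).tendsto.mono_left nhdsWithin_le_nhds
      · filter_upwards [self_mem_nhdsWithin, mem_nhdsWithin_of_mem_nhds
          (isOpen_ne.mem_nhds (inv_ne_zero hz))] with w using hmaps w
    calc 𝓝[ball 0 1] z⁻¹ = Filter.map Inv.inv (Filter.map Inv.inv (𝓝[ball 0 1] z⁻¹)) := by
          rw [Filter.map_map, inv_involutive.comp_self, Filter.map_id]
      _ ≤ Filter.map Inv.inv (𝓝[{w : ℂ | 1 < ‖w‖}] z) := Filter.map_mono hinv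

theorem isStableRoots_iff_of_one_lt_norm (hz : 1 < ‖z‖) :
    IsStableRoots r p a z κ ↔
      Lagrange.nodal Finset.univ κ = innerPoly (reciprocalPoly r p a z⁻¹) := by
  rw [IsStableRoots, nodal_univ_eq_innerPoly_iff,
    enumeratesInnerRoots_iff (norm_pos_iff.1 (one_pos.trans hz))]
  simp [hz, hz.ne']

theorem CauchyStable.isStableRoots_iff_tendsto (hstab : CauchyStable r p a) (hz : ‖z‖ = 1) :
    IsStableRoots r p a z κ ↔
      Tendsto (fun ζ => (innerPoly (reciprocalPoly r p a ζ)).coeff) (𝓝[ball 0 1] z⁻¹)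
        (𝓝 (Lagrange.nodal Finset.univ κ).coeff) := by
  have hz0 : z ≠ 0 := norm_ne_zero_iff.1 (hz ▸ one_ne_zero)
  have hex : ∀ᶠ ζ in 𝓝[ball 0 1] z⁻¹,
      ∃ κ : Fin r → ℂ, Finset.univ.val.map κ = innerRoots (reciprocalPoly r p a ζ) :=
    eventually_nhdsWithin_of_forall fun ζ hζ =>
      hstab.exists_map_univ_eq_innerRoots (mem_ball_zero_iff.1 hζ)
  rw [tendsto_coeff_innerPoly_iff hex, ← map_inv_nhdsWithin_one_lt_norm hz0]
  simp only [IsStableRoots, hz, lt_irrefl, false_and, false_or, true_and]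
  refine forall₂_congr fun ε hε => ?_
  rw [eventually_map, eventually_nhdsWithin_iff, Metric.eventually_nhds_iff]
  refine exists_congr fun δ => and_congr_right fun _ => forall_congr' fun w => ?_
  rw [dist_eq_norm, imp.swap]
  refine imp_congr_right fun _ => imp_congr_right fun hw => exists_congr fun κ' => ?_
  rw [enumeratesInnerRoots_iff (norm_pos_iff.1 (one_pos.trans hw)), pi_norm_lt_iff hε]
  rfl

variable (hr : 1 ≤ r) (har : a (-(r : ℤ)) ≠ 0) (hstab : CauchyStable r p a)
include hr har hstab

theorem isStableRoots_stableRoots (hz : 1 ≤ ‖z‖) :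
    IsStableRoots r p a z (stableRoots r p a z) := by
  have hex : ∃ κ, IsStableRoots r p a z κ := by
    have hz0 : z ≠ 0 := norm_pos_iff.1 (one_pos.trans_le hz)
    rcases hz.lt_or_eq with hz | hz
    · obtain ⟨κ, hκ⟩ := hstab.exists_map_univ_eq_innerRoots (ζ := z⁻¹)
        (by simpa using inv_lt_one_of_one_lt₀ hz)
      exact ⟨κ, Or.inl ⟨hz, (enumeratesInnerRoots_iff hz0).2 hκ⟩⟩
    · obtain ⟨κ, -, hκ⟩ := hstab.exists_tendsto_coeff_innerPoly hr har (inv_ne_zero hz0)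
        (by simp [← hz])
      exact ⟨κ, (hstab.isStableRoots_iff_tendsto hz.symm).2 hκ⟩
  rw [stableRoots, dif_pos hex]
  exact hex.choose_spec

end StableRoots

section StablePoly

/-- The monic polynomial of the stable roots at `z = 1 / ζ`, for `‖ζ‖ ≤ 1`. At `ζ = 0` it is
`X ^ r`, in accordance with the stable roots tending to `0` at infinity: indeed `0⁻¹ = 0` and, no
list being stable at `0`, `stableRoots r p a 0 = 0`. -/
def stablePoly (r p : ℕ) (a : ℤ → ℂ) (ζ : ℂ) : ℂ[X] :=
  Lagrange.nodal Finset.univ (stableRoots r p a ζ⁻¹)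

variable {r p : ℕ} {a : ℤ → ℂ} {z ζ : ℂ}

theorem stablePoly_zero : stablePoly r p a 0 = X ^ r := by
  have hex : ¬∃ κ, IsStableRoots r p a 0 κ := by simp [IsStableRoots]
  simp [stablePoly, stableRoots, hex, Lagrange.nodal]

theorem monic_stablePoly : (stablePoly r p a ζ).Monic := Lagrange.nodal_monic

theorem natDegree_stablePoly : (stablePoly r p a ζ).natDegree = r := natDegree_nodal_univ _

theorem stablePoly_inv :
    stablePoly r p a z⁻¹ = Lagrange.nodal Finset.univ (stableRoots r p a z) := by
  rw [stablePoly, inv_inv]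

variable (hr : 1 ≤ r) (har : a (-(r : ℤ)) ≠ 0) (hstab : CauchyStable r p a)
include hr har hstab

theorem stablePoly_eq_innerPoly (hζ : ‖ζ‖ < 1) :
    stablePoly r p a ζ = innerPoly (reciprocalPoly r p a ζ) := by
  rcases eq_or_ne ζ 0 with rfl | hζ0
  · simp [stablePoly_zero, innerPoly, reciprocalPoly, innerRoots_X_pow]
  · have hz : 1 < ‖ζ⁻¹‖ := by
      rw [norm_inv]
      exact (one_lt_inv₀ (norm_pos_iff.2 hζ0)).2 hζ
    have hs := (isStableRoots_iff_of_one_lt_norm hz).1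
      (isStableRoots_stableRoots hr har hstab hz.le)
    rwa [inv_inv] at hs

theorem tendsto_coeff_innerPoly (hζ : ‖ζ‖ ≤ 1) :
    Tendsto (fun ζ => (innerPoly (reciprocalPoly r p a ζ)).coeff) (𝓝[ball 0 1] ζ)
      (𝓝 (stablePoly r p a ζ).coeff) := by
  rcases hζ.lt_or_eq with hζ | hζ
  · rw [stablePoly_eq_innerPoly hr har hstab hζ]
    exact continuousOn_pi.2 (fun i => (hstab.differentiableOn_coeff_innerPoly i).continuousOn) ζ
      (mem_ball_zero_iff.2 hζ)
  · have hz : ‖ζ⁻¹‖ = 1 := by rw [norm_inv, hζ, inv_one]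
    have hs := (hstab.isStableRoots_iff_tendsto hz).1 (isStableRoots_stableRoots hr har hstab hz.ge)
    rwa [inv_inv] at hs

theorem diffContOnCl_coeff_stablePoly (i : ℕ) :
    DiffContOnCl ℂ (fun ζ => (stablePoly r p a ζ).coeff i) (ball 0 1) := by
  have hball : Set.EqOn (fun ζ => (stablePoly r p a ζ).coeff)
      (fun ζ => (innerPoly (reciprocalPoly r p a ζ)).coeff) (ball 0 1) := fun ζ hζ =>
    congrArg coeff (stablePoly_eq_innerPoly hr har hstab (mem_ball_zero_iff.1 hζ))
  refine ⟨(hstab.differentiableOn_coeff_innerPoly i).congr fun ζ hζ => congrFun (hball hζ) i, ?_⟩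
  have hlim : ∀ ζ ∈ closure (ball (0 : ℂ) 1),
      Tendsto (fun ζ => (innerPoly (reciprocalPoly r p a ζ)).coeff i) (𝓝[ball 0 1] ζ)
        (𝓝 ((stablePoly r p a ζ).coeff i)) := fun ζ hζ => by
    rw [closure_ball (0 : ℂ) one_ne_zero, mem_closedBall_zero_iff] at hζ
    exact tendsto_pi_nhds.1 (tendsto_coeff_innerPoly hr har hstab hζ) i
  exact (continuousOn_extendFrom le_rfl fun ζ hζ => ⟨_, hlim ζ hζ⟩).congr fun ζ hζ =>
    (extendFrom_eq hζ (hlim ζ hζ)).symm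

theorem stableRoots_ne_zero (hz : 1 ≤ ‖z‖) (i : Fin r) : stableRoots r p a z i ≠ 0 := by
  have hz0 : z ≠ 0 := norm_pos_iff.1 (one_pos.trans_le hz)
  have hζ : ‖z⁻¹‖ ≤ 1 := by simpa using inv_le_one_of_one_le₀ hz
  obtain ⟨κ, hκ0, hκ⟩ := hstab.exists_tendsto_coeff_innerPoly hr har (inv_ne_zero hz0) hζ
  have hbot : (𝓝[ball 0 1] z⁻¹).NeBot := by
    rwa [← mem_closure_iff_nhdsWithin_neBot, closure_ball (0 : ℂ) one_ne_zero,
      mem_closedBall_zero_iff]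
  have hnodal :
      Lagrange.nodal Finset.univ κ = Lagrange.nodal Finset.univ (stableRoots r p a z) := by
    rw [← stablePoly_inv]
    exact coeff_injective (tendsto_nhds_unique hκ (tendsto_coeff_innerPoly hr har hstab hζ))
  obtain ⟨σ, hσ⟩ := exists_perm_of_nodal_eq hnodal.symm
  rw [← hσ]
  exact hκ0 (σ i)

end StablePoly

section WindingNumber

variable {c d : ℝ → ℂ} {z₀ : ℂ} {w w' : ℤ}

theorem windingNumber_eq (h : HasWindingNumber c z₀ w) : windingNumber c z₀ = w := by
  have hex : ∃ w, HasWindingNumber c z₀ w := ⟨w, h⟩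
  rw [windingNumber, dif_pos hex]
  exact hex.choose_spec.unique h

theorem HasWindingNumber.mul (hc : HasWindingNumber c 0 w) (hd : HasWindingNumber d 0 w') :
    HasWindingNumber (fun θ => c θ * d θ) 0 (w + w') := by
  obtain ⟨L, hL, hexp, hw⟩ := hc
  obtain ⟨L', hL', hexp', hw'⟩ := hd
  refine ⟨L + L', hL.add hL', fun θ hθ => ?_, ?_⟩
  · rw [Pi.add_apply, Complex.exp_add, ← hexp θ hθ, ← hexp' θ hθ]
    ring
  · push_cast [Pi.add_apply]
    linear_combination hw + hw'

theorem HasWindingNumber.pow (hc : HasWindingNumber c 0 w) (n : ℕ) :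
    HasWindingNumber (fun θ => c θ ^ n) 0 (n * w) := by
  obtain ⟨L, hL, hexp, hw⟩ := hc
  refine ⟨fun θ => n * L θ, hL.const_mul _, fun θ hθ => ?_, ?_⟩
  · rw [Complex.exp_nat_mul, ← hexp θ hθ, sub_zero, sub_zero]
  · push_cast
    linear_combination (n : ℂ) * hw

theorem HasWindingNumber.reverse (hc : HasWindingNumber c z₀ w) :
    HasWindingNumber (fun θ => c (2 * Real.pi - θ)) z₀ (-w) := by
  obtain ⟨L, hL, hexp, hw⟩ := hc
  have hmem : ∀ θ ∈ Set.Icc 0 (2 * Real.pi), 2 * Real.pi - θ ∈ Set.Icc 0 (2 * Real.pi) :=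
    fun θ hθ => ⟨sub_nonneg.2 hθ.2, sub_le_self _ hθ.1⟩
  refine ⟨fun θ => L (2 * Real.pi - θ), hL.comp (by fun_prop) hmem,
    fun θ hθ => hexp _ (hmem θ hθ), ?_⟩
  push_cast
  rw [sub_self, sub_zero]
  linear_combination -hw

theorem hasWindingNumber_zero_of_mem_slitPlane (hc : Continuous c)
    (hclosed : c (2 * Real.pi) = c 0) (hslit : ∀ θ, c θ ∈ Complex.slitPlane) :
    HasWindingNumber c 0 0 := by
  refine ⟨fun θ => Complex.log (c θ), (hc.clog hslit).continuousOn, fun θ _ => ?_, ?_⟩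
  · rw [sub_zero, Complex.exp_log (Complex.slitPlane_ne_zero (hslit θ))]
  · simp [hclosed]

end WindingNumber

section Circle

variable {f : ℂ → ℂ} {c s : ℂ} {R : ℝ}

theorem circleMap_two_pi_eq (c : ℂ) (R : ℝ) : circleMap c R (2 * Real.pi) = circleMap c R 0 := by
  simpa using periodic_circleMap c R 0

theorem hasWindingNumber_circleMap_zero (hR : 0 < R) : HasWindingNumber (circleMap 0 R) 0 1 := by
  refine ⟨fun θ => Real.log R + θ * Complex.I, by fun_prop, fun θ _ => ?_, ?_⟩
  · rw [sub_zero, circleMap_zero, Complex.exp_add, ← Complex.ofReal_exp, Real.exp_log hR]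
  · push_cast
    ring

theorem hasWindingNumber_circleMap_sub (hs : s ∈ ball c R) :
    HasWindingNumber (fun θ => circleMap c R θ - s) 0 1 := by
  have hR : 0 < R := pos_of_mem_ball hs
  have hcirc : ∀ θ, circleMap 0 R θ ≠ 0 := fun θ => circleMap_ne_center (ne_of_gt hR)
  -- Factoring out `R e^{iθ}` leaves a curve in the disk of radius `1` around `1`.
  have hquot : HasWindingNumber (fun θ => 1 + -((s - c) / circleMap 0 R θ)) 0 0 := by
    refine hasWindingNumber_zero_of_mem_slitPlane ?_ ?_ fun θ => ?_
    · have := continuous_circleMap 0 R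
      fun_prop (disch := exact hcirc _)
    · rw [circleMap_two_pi_eq]
    · refine Complex.mem_slitPlane_of_norm_lt_one ?_
      rw [norm_neg, norm_div, norm_circleMap_zero, abs_of_pos hR, div_lt_one hR]
      exact mem_ball_iff_norm.1 hs
  convert (hasWindingNumber_circleMap_zero hR).mul hquot using 1
  · ext θ
    rw [mul_add, mul_neg, mul_div_cancel₀ _ (hcirc θ), mul_one, ← circleMap_sub_center c]
    ring
  · rfl

theorem exists_continuous_retraction_closedBall (hR : 0 < R) :
    ∃ ρ : ℂ → ℂ, Continuous ρ ∧ (∀ z, ρ z ∈ closedBall c R) ∧ ∀ z ∈ closedBall c R, ρ z = z := by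
  have hpos : ∀ z, 0 < max R ‖z - c‖ := fun z => lt_max_of_lt_left hR
  refine ⟨fun z => c + (R / max R ‖z - c‖) • (z - c), ?_, fun z => ?_, fun z hz => ?_⟩
  · exact continuous_const.add <| (continuous_const.div (by fun_prop) fun z => (hpos z).ne').smul
      (by fun_prop)
  · rw [mem_closedBall_iff_norm, add_sub_cancel_left, norm_smul,
      Real.norm_of_nonneg (div_pos hR (hpos z)).le, div_mul_eq_mul_div, div_le_iff₀ (hpos z)]
    exact mul_le_mul_of_nonneg_left (le_max_right _ _) hR.le
  · rw [mem_closedBall_iff_norm] at hz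
    simp [max_eq_left hz, hR.ne']

theorem exists_continuous_log_closedBall (hR : 0 < R) (hf : ContinuousOn f (closedBall c R))
    (h0 : ∀ z ∈ closedBall c R, f z ≠ 0) :
    ∃ L : ℂ → ℂ, Continuous L ∧ ∀ z ∈ closedBall c R, Complex.exp (L z) = f z := by
  obtain ⟨ρ, hρ, hmem, hid⟩ := exists_continuous_retraction_closedBall (c := c) hR
  have hne : ∀ z, (f ∘ ρ) z ≠ 0 := fun z => h0 _ (hmem z)
  obtain ⟨L, ⟨-, hL⟩, -⟩ := Complex.isCoveringMapOn_exp.existsUnique_continuousMap_lifts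
    ⟨f ∘ ρ, hf.comp_continuous hρ hmem⟩ (a₀ := (0 : ℂ)) (Complex.exp_log (hne 0)) hne
  refine ⟨L, L.continuous, fun z hz => (congrFun hL z).trans ?_⟩
  rw [ContinuousMap.coe_mk, Function.comp_apply, hid z hz]

theorem hasWindingNumber_comp_circleMap_of_ne_zero (hR : 0 < R)
    (hf : ContinuousOn f (closedBall c R)) (h0 : ∀ z ∈ closedBall c R, f z ≠ 0) :
    HasWindingNumber (fun θ => f (circleMap c R θ)) 0 0 := by
  obtain ⟨L, hL, hexp⟩ := exists_continuous_log_closedBall hR hf h0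
  refine ⟨fun θ => L (circleMap c R θ), (hL.comp (continuous_circleMap c R)).continuousOn,
    fun θ _ => ?_, ?_⟩
  · rw [sub_zero, hexp _ (circleMap_mem_closedBall c hR.le θ)]
  · simp [circleMap_two_pi_eq]

end Circle

section ArgumentPrinciple

variable {f : ℂ → ℂ} {c s z : ℂ} {R : ℝ}

theorem eventually_ne_zero_of_ne_zero_on_sphere (hf : DiffContOnCl ℂ f (ball c R))
    (h0 : ∀ z ∈ sphere c R, f z ≠ 0) (hz : z ∈ ball c R) : ∀ᶠ w in 𝓝[≠] z, f w ≠ 0 := by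
  by_contra hfreq
  have hR : 0 < R := pos_of_mem_ball hz
  have hball : Set.EqOn f 0 (ball c R) :=
    (hf.differentiableOn.analyticOnNhd isOpen_ball).eqOn_zero_of_preconnected_of_frequently_eq_zero
      (convex_ball c R).isPreconnected hz
      ((not_eventually.1 hfreq).mono fun w => not_not.1)
  have hclosed : Set.EqOn f 0 (closedBall c R) :=
    hball.of_subset_closure hf.continuousOn_ball continuousOn_const ball_subset_closedBall
      (closure_ball c hR.ne').ge
  obtain ⟨w, hw⟩ := NormedSpace.sphere_nonempty (x := c).2 hR.le
  exact h0 w hw (hclosed (sphere_subset_closedBall hw))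

theorem analyticOrderAt_ne_top_of_ne_zero_on_sphere (hf : DiffContOnCl ℂ f (ball c R))
    (h0 : ∀ z ∈ sphere c R, f z ≠ 0) (hz : z ∈ ball c R) : analyticOrderAt f z ≠ ⊤ := fun htop =>
  ((eventually_ne_zero_of_ne_zero_on_sphere hf h0 hz).and
    (nhdsWithin_le_nhds (analyticOrderAt_eq_top.1 htop))).exists.elim fun _ h => h.1 h.2

theorem finite_zeros_ball (hf : DiffContOnCl ℂ f (ball c R)) (h0 : ∀ z ∈ sphere c R, f z ≠ 0) :
    {z ∈ ball c R | f z = 0}.Finite := by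
  by_contra hinf
  obtain ⟨x, -, hx⟩ := Set.Infinite.exists_accPt_of_subset_isCompact hinf
    (isCompact_closedBall c R) fun z hz => ball_subset_closedBall hz.1
  rw [accPt_iff_frequently_nhdsNE] at hx
  have hclosed : IsClosed (closedBall c R ∩ f ⁻¹' {0}) :=
    hf.continuousOn_ball.preimage_isClosed_of_isClosed isClosed_closedBall isClosed_singleton
  have hmem : x ∈ closedBall c R ∩ f ⁻¹' {0} := by
    rw [← hclosed.closure_eq, mem_closure_iff_frequently]
    exact (hx.filter_mono nhdsWithin_le_nhds).mono fun z hz => ⟨ball_subset_closedBall hz.1, hz.2⟩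
  have hball : x ∈ ball c R := lt_of_le_of_ne hmem.1 fun hs => h0 x hs hmem.2
  exact hx ((eventually_ne_zero_of_ne_zero_on_sphere hf h0 hball).mono fun z hz h => hz h.2)

theorem analyticOrderNatAt_sub_self (s : ℂ) : analyticOrderNatAt (fun z => z - s) s = 1 := by
  have h : analyticOrderAt (fun z => z - s) s = 1 :=
    AnalyticAt.analyticOrderAt_eq_one_of_zero_deriv_ne_zero (by fun_prop) (sub_self s) (by simp)
  simp [analyticOrderNatAt, h]

theorem eq_of_analyticOrderNatAt_sub_ne_zero (hz : analyticOrderNatAt (fun w => w - s) z ≠ 0) :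
    z = s :=
  sub_eq_zero.1 (apply_eq_zero_of_analyticOrderNatAt_ne_zero (f := fun w => w - s) hz)

theorem finsum_mem_analyticOrderNatAt_sub {U : Set ℂ} (hs : s ∈ U) :
    ∑ᶠ z ∈ U, analyticOrderNatAt (fun w => w - s) z = 1 := by
  rw [finsum_mem_inter_support_eq' _ U {s} fun z hz => by
      simpa [eq_of_analyticOrderNatAt_sub_ne_zero hz] using hs,
    finsum_mem_singleton, analyticOrderNatAt_sub_self]

theorem diffContOnCl_dslope (hf : DiffContOnCl ℂ f (ball c R)) (hs : s ∈ ball c R) :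
    DiffContOnCl ℂ (dslope f s) (ball c R) := by
  have hnhds : ball c R ∈ 𝓝 s := isOpen_ball.mem_nhds hs
  exact ⟨(Complex.differentiableOn_dslope hnhds).2 hf.differentiableOn,
    (continuousOn_dslope (mem_of_superset hnhds subset_closure)).2
      ⟨hf.continuousOn, hf.differentiableAt isOpen_ball hs⟩⟩

theorem analyticOrderNatAt_eq_add_dslope (hf : DiffContOnCl ℂ f (ball c R))
    (h0 : ∀ z ∈ sphere c R, f z ≠ 0) (hs : s ∈ ball c R) (hfs : f s = 0) (hz : z ∈ ball c R) :
    analyticOrderNatAt f z =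
      analyticOrderNatAt (fun w => w - s) z + analyticOrderNatAt (dslope f s) z := by
  have hmul : f = (fun w => w - s) * dslope f s :=
    funext fun w => (sub_smul_dslope_of_zero hfs w).symm
  have hsub : AnalyticAt ℂ (fun w => w - s) z := by fun_prop
  have hslope : AnalyticAt ℂ (dslope f s) z :=
    (diffContOnCl_dslope hf hs).differentiableOn.analyticOnNhd isOpen_ball z hz
  have htop : analyticOrderAt ((fun w => w - s) * dslope f s) z ≠ ⊤ :=
    hmul ▸ analyticOrderAt_ne_top_of_ne_zero_on_sphere hf h0 hz
  rw [analyticOrderAt_mul hsub hslope] at htop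
  obtain ⟨hsub_top, hslope_top⟩ := WithTop.add_ne_top.1 htop
  rw [← analyticOrderNatAt_mul hsub hslope hsub_top hslope_top, ← hmul]

theorem dslope_ne_zero_of_ne_zero (hfs : f s = 0) (hfz : f z ≠ 0) : dslope f s z ≠ 0 := fun h =>
  hfz (by rw [← sub_smul_dslope_of_zero hfs z, h, smul_zero])

theorem finite_support_analyticOrderNatAt (hf : DiffContOnCl ℂ f (ball c R))
    (h0 : ∀ z ∈ sphere c R, f z ≠ 0) :
    (ball c R ∩ Function.support fun z => analyticOrderNatAt f z).Finite :=
  (finite_zeros_ball hf h0).subset fun _ hz =>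
    ⟨hz.1, apply_eq_zero_of_analyticOrderNatAt_ne_zero hz.2⟩

theorem finsum_mem_analyticOrderNatAt_eq_add_one (hf : DiffContOnCl ℂ f (ball c R))
    (h0 : ∀ z ∈ sphere c R, f z ≠ 0) (hs : s ∈ ball c R) (hfs : f s = 0) :
    ∑ᶠ z ∈ ball c R, analyticOrderNatAt f z =
      1 + ∑ᶠ z ∈ ball c R, analyticOrderNatAt (dslope f s) z := by
  have hsupp :
      (ball c R ∩ Function.support fun z => analyticOrderNatAt (fun w => w - s) z).Finite :=
    (Set.finite_singleton s).subset fun _ hz => eq_of_analyticOrderNatAt_sub_ne_zero hz.2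
  rw [finsum_mem_congr rfl fun z hz => analyticOrderNatAt_eq_add_dslope hf h0 hs hfs hz,
    finsum_mem_add_distrib' hsupp (finite_support_analyticOrderNatAt (diffContOnCl_dslope hf hs)
      fun z hz => dslope_ne_zero_of_ne_zero hfs (h0 z hz)),
    finsum_mem_analyticOrderNatAt_sub hs]

theorem hasWindingNumber_comp_circleMap (hR : 0 < R) (hf : DiffContOnCl ℂ f (ball c R))
    (h0 : ∀ z ∈ sphere c R, f z ≠ 0) :
    HasWindingNumber (fun θ => f (circleMap c R θ)) 0
      (∑ᶠ z ∈ ball c R, analyticOrderNatAt f z : ℕ) := by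
  induction hn : ∑ᶠ z ∈ ball c R, analyticOrderNatAt f z generalizing f with
  | zero =>
    refine hasWindingNumber_comp_circleMap_of_ne_zero hR hf.continuousOn_ball fun z hz hfz => ?_
    have hball : z ∈ ball c R := lt_of_le_of_ne hz fun hs => h0 z hs hfz
    rw [finsum_mem_analyticOrderNatAt_eq_add_one hf h0 hball hfz] at hn
    omega
  | succ n ih =>
    obtain ⟨s, hs, hord⟩ := exists_ne_zero_of_finsum_mem_ne_zero (hn.trans_ne n.succ_ne_zero)
    have hfs : f s = 0 := apply_eq_zero_of_analyticOrderNatAt_ne_zero hord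
    rw [finsum_mem_analyticOrderNatAt_eq_add_one hf h0 hs hfs, add_comm, Nat.succ_inj] at hn
    have hslope := ih (diffContOnCl_dslope hf hs)
      (fun z hz => dslope_ne_zero_of_ne_zero hfs (h0 z hz)) hn
    convert (hasWindingNumber_circleMap_sub hs).mul hslope using 1
    · exact funext fun θ => (sub_smul_dslope_of_zero hfs _).symm
    · push_cast
      ring

end ArgumentPrinciple

section Exterior

variable {z : ℂ}

theorem isOpen_exterior : IsOpen {z : ℂ | 1 < ‖z‖} := isOpen_lt continuous_const continuous_norm

theorem inv_mem_ball (hz : 1 < ‖z‖) : z⁻¹ ∈ ball (0 : ℂ) 1 := by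
  simpa using inv_lt_one_of_one_lt₀ hz

theorem inv_mem_closedBall (hz : 1 ≤ ‖z‖) : z⁻¹ ∈ closedBall (0 : ℂ) 1 := by
  simpa using inv_le_one_of_one_le₀ hz

theorem ne_zero_of_one_le_norm (hz : 1 ≤ ‖z‖) : z ≠ 0 := norm_pos_iff.1 (one_pos.trans_le hz)

variable {f h : ℂ → ℂ} {r : ℕ} (hfh : ∀ z, 1 ≤ ‖z‖ → f z = z ^ r * h z⁻¹)
include hfh

theorem eq_zero_iff_of_eq_pow_mul_comp_inv (hz : 1 ≤ ‖z‖) : f z = 0 ↔ h z⁻¹ = 0 := by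
  simp [hfh z hz, ne_zero_of_one_le_norm hz]

theorem ne_zero_on_sphere_of_eq_pow_mul_comp_inv (hne : ∀ z, ‖z‖ = 1 → f z ≠ 0) :
    ∀ ζ ∈ sphere (0 : ℂ) 1, h ζ ≠ 0 := fun ζ hζ hhζ => by
  have hnorm : ‖ζ⁻¹‖ = 1 := by rw [norm_inv, mem_sphere_zero_iff_norm.1 hζ, inv_one]
  exact hne _ hnorm ((eq_zero_iff_of_eq_pow_mul_comp_inv hfh hnorm.ge).2 (by rwa [inv_inv]))

theorem bijOn_inv_zeros (hh0 : h 0 ≠ 0) :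
    Set.BijOn Inv.inv {z | 1 < ‖z‖ ∧ f z = 0} {ζ ∈ ball 0 1 | h ζ = 0} := by
  refine ⟨fun z hz => ⟨inv_mem_ball hz.1, (eq_zero_iff_of_eq_pow_mul_comp_inv hfh hz.1.le).1 hz.2⟩,
    inv_injective.injOn, fun ζ ⟨hζ, hhζ⟩ => ⟨ζ⁻¹, ?_, inv_inv ζ⟩⟩
  have hζ0 : ζ ≠ 0 := fun h => hh0 (h ▸ hhζ)
  have hnorm : 1 < ‖ζ⁻¹‖ := by
    rw [norm_inv]
    exact (one_lt_inv₀ (norm_pos_iff.2 hζ0)).2 (mem_ball_zero_iff.1 hζ)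
  exact ⟨hnorm, (eq_zero_iff_of_eq_pow_mul_comp_inv hfh hnorm.le).2 (by rwa [inv_inv])⟩

theorem hasWindingNumber_of_eq_pow_mul_comp_inv {w : ℤ}
    (hw : HasWindingNumber (fun θ => h (circleMap 0 1 θ)) 0 w) :
    HasWindingNumber (fun θ : ℝ => f (Complex.exp (Complex.I * θ))) 0 (r - w) := by
  convert ((hasWindingNumber_circleMap_zero one_pos).pow r).mul hw.reverse using 1
  · ext θ
    have hexp : Complex.exp (Complex.I * θ) = circleMap 0 1 θ := by simp [circleMap, mul_comm]
    have hinv : (circleMap 0 1 θ)⁻¹ = circleMap 0 1 (2 * Real.pi - θ) := by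
      rw [circleMap_zero_inv, inv_one, ← periodic_circleMap 0 1 (-θ), neg_add_eq_sub]
    rw [hexp, hfh _ (by simp), hinv]
  · ring

variable (hh : DiffContOnCl ℂ h (ball 0 1))
include hh

theorem analyticOnNhd_of_eq_pow_mul_comp_inv : AnalyticOnNhd ℂ f {z | 1 < ‖z‖} := by
  have hdiff : DifferentiableOn ℂ (fun z => z ^ r * h z⁻¹) {z | 1 < ‖z‖} :=
    (differentiableOn_pow r).mul <| hh.differentiableOn.comp
      (differentiableOn_inv.mono fun _ hz => ne_zero_of_one_le_norm (le_of_lt hz))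
      fun _ hz => inv_mem_ball hz
  exact (hdiff.congr fun z hz => hfh z (le_of_lt hz)).analyticOnNhd isOpen_exterior

theorem continuousOn_of_eq_pow_mul_comp_inv : ContinuousOn f {z | 1 ≤ ‖z‖} := by
  have hcont : ContinuousOn (fun z => z ^ r * h z⁻¹) {z | 1 ≤ ‖z‖} :=
    (continuousOn_pow r).mul <| hh.continuousOn_ball.comp
      (continuousOn_inv₀.mono fun _ hz => ne_zero_of_one_le_norm hz)
      fun _ hz => inv_mem_closedBall hz
  exact hcont.congr hfh

theorem analyticOrderNatAt_of_eq_pow_mul_comp_inv (hz : 1 < ‖z‖) :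
    analyticOrderNatAt f z = analyticOrderNatAt h z⁻¹ := by
  have hz0 : z ≠ 0 := ne_zero_of_one_le_norm hz.le
  have hev : f =ᶠ[𝓝 z] (fun w => w ^ r) * (h ∘ Inv.inv) :=
    (isOpen_exterior.eventually_mem hz).mono fun w hw => hfh w (le_of_lt hw)
  have hpow : analyticOrderAt (fun w : ℂ => w ^ r) z = 0 :=
    analyticOrderAt_eq_zero.2 (.inr (pow_ne_zero r hz0))
  have hinv : AnalyticAt ℂ Inv.inv z := analyticAt_inv hz0
  have hcomp : AnalyticAt ℂ (h ∘ Inv.inv) z :=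
    (hh.differentiableOn.analyticOnNhd isOpen_ball _ (inv_mem_ball hz)).comp hinv
  rw [analyticOrderNatAt, analyticOrderNatAt, analyticOrderAt_congr hev,
    analyticOrderAt_mul (by fun_prop) hcomp, hpow, zero_add,
    analyticOrderAt_comp_of_deriv_ne_zero hinv (by simp [deriv_inv, hz0])]

variable (hh0 : h 0 ≠ 0) (hne : ∀ z, ‖z‖ = 1 → f z ≠ 0)
include hh0 hne

theorem finite_zeros_exterior : {z | 1 < ‖z‖ ∧ f z = 0}.Finite := by
  have hfin := finite_zeros_ball hh (ne_zero_on_sphere_of_eq_pow_mul_comp_inv hfh hne)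
  exact (bijOn_inv_zeros hfh hh0).finite_iff_finite.2 hfin

theorem finsum_mem_analyticOrderNatAt_exterior :
    ∑ᶠ z ∈ {z | 1 < ‖z‖ ∧ f z = 0}, (analyticOrderNatAt f z : ℤ) =
      r - windingNumber (fun θ : ℝ => f (Complex.exp (Complex.I * θ))) 0 := by
  have hsphere := ne_zero_on_sphere_of_eq_pow_mul_comp_inv hfh hne
  have hcount : ∑ᶠ z ∈ {z | 1 < ‖z‖ ∧ f z = 0}, analyticOrderNatAt f z =
      ∑ᶠ ζ ∈ ball 0 1, analyticOrderNatAt h ζ := by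
    rw [finsum_mem_eq_of_bijOn Inv.inv (bijOn_inv_zeros hfh hh0) fun z hz =>
      analyticOrderNatAt_of_eq_pow_mul_comp_inv hfh hh hz.1]
    exact finsum_mem_inter_support_eq' _ _ _ fun ζ hζ =>
      ⟨And.left, fun hball => ⟨hball, apply_eq_zero_of_analyticOrderNatAt_ne_zero hζ⟩⟩
  rw [windingNumber_eq (hasWindingNumber_of_eq_pow_mul_comp_inv hfh
      (hasWindingNumber_comp_circleMap one_pos hh hsphere)), sub_sub_cancel, ← hcount,
    Nat.cast_finsum_mem (finite_zeros_exterior hfh hh hh0 hne)]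

end Exterior

section IntrinsicDet

/-- The intrinsic Kreiss-Lopatinskii determinant of a scheme whose first `r` rows
`U_j^{n+1} = ∑_k A_{j,k} U_k^n`, `0 ≤ j ≤ r - 1`, are prescribed directly by a matrix `A`. -/
def generalIntrinsicDet (r p : ℕ) (a : ℤ → ℂ) {m : ℕ} (A : Matrix (Fin r) (Fin m) ℂ) (z : ℂ) : ℂ :=
  (z • K r p a r z - A * K r p a m z).det / (K r p a r z).det

/-- The function `ζ ↦ ζ ^ r Δ(1 / ζ)`, written so that it makes sense at `ζ = 0`, i.e. at
infinity for `Δ`. -/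
def reciprocalIntrinsicDet (r p : ℕ) (a : ℤ → ℂ) {m : ℕ} (A : Matrix (Fin r) (Fin m) ℂ) (ζ : ℂ) :
    ℂ :=
  (1 - ζ • (A * remainderMatrix m r (stablePoly r p a ζ))).det

variable {r p m : ℕ} {a : ℤ → ℂ} (A : Matrix (Fin r) (Fin m) ℂ)

theorem reciprocalIntrinsicDet_zero_ne_zero : reciprocalIntrinsicDet r p a A 0 ≠ 0 := by
  simp [reciprocalIntrinsicDet]

variable (hr : 1 ≤ r) (har : a (-(r : ℤ)) ≠ 0) (hstab : CauchyStable r p a)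
include hr har hstab

theorem generalIntrinsicDet_eq (z : ℂ) (hz : 1 ≤ ‖z‖) :
    generalIntrinsicDet r p a A z = z ^ r * reciprocalIntrinsicDet r p a A z⁻¹ := by
  have hfactor (C : Matrix (Fin r) (Fin r) ℂ) : z • 1 - C = z • (1 - z⁻¹ • C) := by
    rw [smul_sub, smul_inv_smul₀ (ne_zero_of_one_le_norm hz)]
  rw [generalIntrinsicDet, K, K, det_basisMatrix_quotient (stableRoots_ne_zero hr har hstab hz),
    ← stablePoly_inv, hfactor, Matrix.det_smul, Fintype.card_fin, reciprocalIntrinsicDet]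

theorem diffContOnCl_reciprocalIntrinsicDet :
    DiffContOnCl ℂ (reciprocalIntrinsicDet r p a A) (ball 0 1) := by
  have hrem : ∀ j i, DiffContOnCl ℂ
      (fun ζ => remainderMatrix m r (stablePoly r p a ζ) j i) (ball 0 1) := fun j i =>
    diffContOnCl_coeff_X_pow_modByMonic (fun _ => monic_stablePoly) (fun _ => natDegree_stablePoly)
      (diffContOnCl_coeff_stablePoly hr har hstab) j i
  refine diffContOnCl_det fun i k => ?_
  simp only [Matrix.sub_apply, Matrix.smul_apply, Matrix.mul_apply]
  exact diffContOnCl_const.sub <| differentiable_id.diffContOnCl.smul <|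
    diffContOnCl_finset_sum _ fun j _ => (hrem j k).const_smul (A i j)

end IntrinsicDet

theorem corollary3p2_general {r p m : ℕ} (hr : 1 ≤ r) {a : ℤ → ℂ} (har : a (-(r : ℤ)) ≠ 0)
    (hstab : CauchyStable r p a) (A : Matrix (Fin r) (Fin m) ℂ)
    (h0 : ∀ z : ℂ, ‖z‖ = 1 → generalIntrinsicDet r p a A z ≠ 0) :
    AnalyticOnNhd ℂ (generalIntrinsicDet r p a A) {z : ℂ | 1 < ‖z‖} ∧
    ContinuousOn (generalIntrinsicDet r p a A) {z : ℂ | 1 ≤ ‖z‖} ∧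
    {z : ℂ | 1 < ‖z‖ ∧ generalIntrinsicDet r p a A z = 0}.Finite ∧
    ∑ᶠ z ∈ {z : ℂ | 1 < ‖z‖ ∧ generalIntrinsicDet r p a A z = 0},
        (analyticOrderNatAt (generalIntrinsicDet r p a A) z : ℤ) =
      (r : ℤ) - windingNumber
        (fun θ : ℝ => generalIntrinsicDet r p a A (Complex.exp (Complex.I * (θ : ℂ)))) 0 := by
  have heq := generalIntrinsicDet_eq A hr har hstab
  have hdiff := diffContOnCl_reciprocalIntrinsicDet A hr har hstab
  have hinfty : reciprocalIntrinsicDet r p a A 0 ≠ 0 := reciprocalIntrinsicDet_zero_ne_zero A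
  exact ⟨analyticOnNhd_of_eq_pow_mul_comp_inv heq hdiff,
    continuousOn_of_eq_pow_mul_comp_inv heq hdiff,
    finite_zeros_exterior heq hdiff hinfty h0,
    finsum_mem_analyticOrderNatAt_exterior heq hdiff hinfty h0⟩

end KreissLopatinskii

end

open KreissLopatinskii in
/-- Holomorphy of `Δ` on `{|z| > 1}` and its continuity on `{|z| ≥ 1}` are part of the conclusion:
they give a meaning to the multiplicities of the zeros and to the winding number. -/
theorem corollary3p2 (r p m : ℕ) (hr : 1 ≤ r) (hp : 1 ≤ p) (hm : p + r ≤ m)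
    (a : ℤ → ℂ) (har : a (-(r : ℤ)) ≠ 0) (hap : a (p : ℤ) ≠ 0)
    (B : Matrix (Fin r) (Fin m) ℂ)
    (hstab : CauchyStable r p a)
    (h0 : ∀ z : ℂ, ‖z‖ = 1 → intrinsicDet r p m a B z ≠ 0) :
    AnalyticOnNhd ℂ (intrinsicDet r p m a B) {z : ℂ | 1 < ‖z‖} ∧
    ContinuousOn (intrinsicDet r p m a B) {z : ℂ | 1 ≤ ‖z‖} ∧
    {z : ℂ | 1 < ‖z‖ ∧ intrinsicDet r p m a B z = 0}.Finite ∧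
    ∑ᶠ z ∈ {z : ℂ | 1 < ‖z‖ ∧ intrinsicDet r p m a B z = 0},
        (analyticOrderNatAt (intrinsicDet r p m a B) z : ℤ) =
      (r : ℤ) - windingNumber
        (fun θ : ℝ => intrinsicDet r p m a B (Complex.exp (Complex.I * (θ : ℂ)))) 0 :=
  corollary3p2_general hr har hstab (boundaryMatrix r p m a B) h0
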